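/- Work with formal planar vector fields over $\mathbb R$. For $-1\le l\le k+1$, respectively $0\le l\le k$, put $$A^l_k=\tfrac{k-l+1}{k+2}x^{l+1}y^{k-l}\partial_x-\tfrac{l+1}{k+2}x^ly^{k-l+1}\partial_y,\qquad B^l_k=x^{l+1}y^{k-l}\partial_x+x^ly^{k-l+1}\partial_y,\qquad Z^l_k=x^ly^{k-l}\ (0\le l\le k).$$ Let $r,s\ge 1$ be integers with $r<2s$, let $a_k$ ($k\ge r$) and $b_k$ ($k\ge s$) be real numbers with $a_r\ne0$, $b_s\ne 0$, and let $$v^{(1)}=A^1_0+\sum_{k\ge r}a_kA^{-1}_k+\sum_{k\ge s}b_kB^0_k ,$$ that is, $\dot x=\sum_{k\ge r} a_ky^{k+1}+\sum_{k\ge s} b_kxy^k$, $\dot y=-x+\sum_{k\ge s} b_ky^{k+1}$ (the generalized cusp case of a Bogdanov–Takens first level normal form). Grade by $\delta(A^l_k)=\delta(B^l_k)=\delta(Z^l_k)=lr+2k$ (so $x$ has weight $r+2$ and $y$ has weight $2$). Let $\mathscr L_k$ be the span of the $A^l_n,B^l_n$ of grade $k$ with $n\ge1$, together with $A^1_0$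 if $k=r$, and let $\mathcal R_k$ be the span of the $Z^l_n$ of grade $k$ with $n\ge 1$. Put $\mathcal G_k=\mathcal R_k\times\mathscr L_k$ for $k\ge1$ and $\mathcal G_k=0$ for $k\le 0$. For a vector field $w$ with grade $i$ components $w_i$, and integers $\rho\ge1$ and $k$, let $$d^{k,\rho}\big((T_{k-i},S_{k-i})_{0\le i<\rho}\big)=\sum_{i=0}^{\rho-1}\big(T_{k-i}w_i+[S_{k-i},w_i]\big),$$ with domain $\mathcal G_k$ if $\rho=1$ and $\ker d^{k-1,\rho-1}\times\mathcal G_k$ if $\rho\ge2$. Let $C^\rho_k$ be the subspace of $\mathscr L_k$ spanned by those terms $A^l_n,B^l_n$ of $\mathscr L_k$ that are not congruent modulo $\operatorname{im}d^{k,\rho}$ to a linear combination of terms of $\mathscr L_k$ that come later in the priority of elimination; in this priority terms with smaller lower index $n$ come first, and for equal $n$ the $B$-term comes before the $A$-term. A *$\rho$-th level partially extended orbital normal form* of $v$ is a vector field $w$ such that (a) $w$ is obtained from $v$ by a formal near-identity change of state variables $(x,y)=\varphi(X,Y)$ (tangent to the identity at the origin, with $\varphi-\mathrm{id}$ consisting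 of terms of positive grade, where a term in the $x$- or $y$-component has as its grade the weight of its monomial minus that of $x$ or $y$, respectively) followed by a time rescaling $u\mapsto u+Tu$ with a formal power series $T$, $T(0,0)=0$; and (b) for every $k\in\mathbb Z$ the space $C^\rho_k$ is a complement to $\operatorname{im} d^{k,\rho}$ in $\mathscr L_k$ and $w_k\in C^\rho_k$. **Theorem.** The vector field $v^{(1)}$ has an $(r+1)$-th level partially extended orbital normal form, and every such normal form is $$v^{(r+1)}=A^1_0+a_rA^{-1}_r+\sum_{k\ge s}\tilde b_kB^0_k$$ for some real numbers $\tilde b_k$ with $\tilde b_k=0$ whenever $k\equiv-1\pmod{r+2}$. (The coefficients $\tilde b_k$ are in general different from the $b_k$ of $v^{(1)}$, and $a_r$ is unchanged.) -/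

import Mathlib

noncomputable section

namespace CuspNF

/-- Formal power series over `ℝ` in the state variables `x = X 0` and `y = X 1`. -/
abbrev Series : Type := MvPowerSeries (Fin 2) ℝ

/-- Formal planar vector fields: `v` stands for `v 0 ∂/∂x + v 1 ∂/∂y`. -/
abbrev VField : Type := Fin 2 → Series

/-- The monomial `x ^ i * y ^ j`. -/
def mono (i j : ℕ) : Series := MvPowerSeries.X 0 ^ i * MvPowerSeries.X 1 ^ j

/-- The Hamiltonian vector fields `A^l_k`, for `-1 ≤ l ≤ k + 1`. In this range an exponent is
negative only in a component whose coefficient is zero. -/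
def vA (l : ℤ) (k : ℕ) : VField :=
  ![(((k - l + 1 : ℤ) : ℝ) / ((k : ℝ) + 2)) • mono (l + 1).toNat (k - l).toNat,
    -((((l + 1 : ℤ) : ℝ) / ((k : ℝ) + 2)) • mono l.toNat (k - l + 1).toNat)]

/-- The Eulerian vector fields `B^l_k`, for `0 ≤ l ≤ k`. -/
def vB (l : ℤ) (k : ℕ) : VField :=
  ![mono (l + 1).toNat (k - l).toNat, mono l.toNat (k - l + 1).toNat]

/-- The coefficientwise sum of a sequence of vector fields; it is used for sequences in which
each monomial occurs in only finitely many members. -/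
def formalSum (f : ℕ → VField) : VField :=
  fun i n => ∑ᶠ j : ℕ, MvPowerSeries.coeff n (f j i)

/-- The Lie bracket `[v, w] = v(w) - w(v)`, as a function of `v` that is linear over `ℝ`. -/
def bracketRight (w : VField) : VField →ₗ[ℝ] VField where
  toFun v := fun i =>
    ∑ j, (v j * MvPowerSeries.pderiv ℝ j (w i) - w j * MvPowerSeries.pderiv ℝ j (v i))
  map_add' u v := by
    funext i
    simp only [Pi.add_apply, map_add, Fin.sum_univ_two]
    ring
  map_smul' c v := by
    funext i
    simp only [Pi.smul_apply, Derivation.map_smul, Fin.sum_univ_two, RingHom.id_apply,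
      smul_mul_assoc, mul_smul_comm, smul_add, smul_sub]

/-- The Lie bracket of formal vector fields. -/
def bracket (v w : VField) : VField := bracketRight w v

/-! ### The grading `δ(A^l_k) = δ(B^l_k) = δ(Z^l_k) = l r + 2 k` -/

/-- The grade of the monomial with exponent `n`: `x` has weight `r + 2` and `y` has weight `2`,
so that `Z^l_k = x ^ l * y ^ (k - l)` has grade `l r + 2 k`. -/
def weight (r : ℕ) (n : Fin 2 →₀ ℕ) : ℤ := ((r : ℤ) + 2) * n 0 + 2 * n 1

/-- The weight of the variable `x` (`i = 0`) or `y` (`i = 1`). -/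
def varWeight (r : ℕ) (i : Fin 2) : ℤ := weight r (Finsupp.single i 1)

/-- The component of grade `k` of a formal vector field. -/
def component (r : ℕ) (k : ℤ) (v : VField) : VField :=
  fun i n => if weight r n - varWeight r i = k then MvPowerSeries.coeff n (v i) else 0

/-- The terms `A^l_k` and `B^l_k`, as symbols. -/
inductive Term where
  | A (l : ℤ) (k : ℕ) : Term
  | B (l : ℤ) (k : ℕ) : Term

/-- The vector field of a term. -/
def Term.field : Term → VField
  | .A l k => vA l k
  | .B l k => vB l k

/-- The lower index of a term: the field is homogeneous of degree `k + 1` in `(x, y)`. -/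
def Term.deg : Term → ℕ
  | .A _ k => k
  | .B _ k => k

/-- The grade of a term. -/
def Term.grade (r : ℕ) : Term → ℤ
  | .A l k => l * r + 2 * k
  | .B l k => l * r + 2 * k

/-- The terms that span the Lie algebra: `A^1_0`, and all `A^l_k` and `B^l_k` with `k ≥ 1`. -/
def Term.Admissible : Term → Prop
  | .A l k => -1 ≤ l ∧ l ≤ k + 1 ∧ (1 ≤ k ∨ (k = 0 ∧ l = 1))
  | .B l k => 0 ≤ l ∧ l ≤ k ∧ 1 ≤ k

/-- Priority of elimination: a term of lower degree is eliminated before one of higher degree,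
and of two terms of the same degree the `B`-term is eliminated before the `A`-term. -/
def Term.Before : Term → Term → Prop
  | .A _ k, .A _ k' => k < k'
  | .A _ k, .B _ k' => k < k'
  | .B _ k, .A _ k' => k ≤ k'
  | .B _ k, .B _ k' => k < k'

/-- The homogeneous part of grade `k` of the Lie algebra of vector fields. -/
def gradedL (r : ℕ) (k : ℤ) : Submodule ℝ VField :=
  Submodule.span ℝ {v | ∃ t : Term, t.Admissible ∧ t.grade r = k ∧ v = t.field}

/-- The homogeneous part of grade `k` of the ring of time rescaling generators, which is spanned
by the `Z^l_n = x ^ l * y ^ (n - l)` with `n ≥ 1`. -/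
def gradedR (r : ℕ) (k : ℤ) : Submodule ℝ Series :=
  Submodule.span ℝ {f | ∃ l n : ℕ, 1 ≤ n ∧ l ≤ n ∧ (l : ℤ) * r + 2 * n = k ∧ f = mono l (n - l)}

/-- Pairs `(T, S)` of a time rescaling generator and a state generator, both homogeneous of
grade `k`. Generators of near-identity transformations have positive grade. -/
def gens (r : ℕ) (k : ℤ) : Submodule ℝ (Series × VField) :=
  if 1 ≤ k then (gradedR r k).prod (gradedL r k) else ⊥

/-! ### The maps `d^{k,ρ}`

A tuple `(T_{k-ρ+1}, …, T_k, S_{k-ρ+1}, …, S_k)` is written as a sequence `p` whose entry `p i` is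
`(T_{k-i}, S_{k-i})`; only the entries with `i < ρ` matter. -/

/-- The linear map `(T, S) ↦ T u + [S, u]`. -/
def actOn (u : VField) : (Series × VField) →ₗ[ℝ] VField where
  toFun p := p.1 • u + bracketRight u p.2
  map_add' p q := by
    simp only [Prod.fst_add, Prod.snd_add, map_add, add_smul]
    abel
  map_smul' c p := by
    simp only [Prod.smul_fst, Prod.smul_snd, map_smul, smul_assoc, smul_add, RingHom.id_apply]

/-- The formula of `d^{k,ρ}`: `∑_{i < ρ} (T_{k-i} v_i + [S_{k-i}, v_i])`. -/
def dMap (r : ℕ) (v : VField) (ρ : ℕ) : (ℕ → Series × VField) →ₗ[ℝ] VField :=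
  ∑ i ∈ Finset.range ρ, (actOn (component r i v)).comp (LinearMap.proj i)

/-- Dropping the entry of the highest grade. -/
def dropTop : (ℕ → Series × VField) →ₗ[ℝ] (ℕ → Series × VField) :=
  LinearMap.funLeft ℝ (Series × VField) Nat.succ

/-- The domain of `d^{k,ρ}`: it is `R_k × L_k` for `ρ = 1` and
`ker d^{k-1,ρ-1} × R_k × L_k` for `ρ ≥ 2`. -/
def dDom (r : ℕ) (v : VField) : ℕ → ℤ → Submodule ℝ (ℕ → Series × VField)
  | 0, _ => ⊤
  | ρ + 1, k =>
      (gens r k).comap (LinearMap.proj 0) ⊓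
        (dDom r v ρ (k - 1) ⊓ LinearMap.ker (dMap r v ρ)).comap dropTop

/-- The image of `d^{k,ρ}`. -/
def dImage (r : ℕ) (v : VField) (ρ : ℕ) (k : ℤ) : Submodule ℝ VField :=
  (dDom r v ρ k).map (dMap r v ρ)

/-- The space `C^ρ_k` of the normal form style: it is spanned by the terms of grade `k` that
cannot be eliminated, i.e. that do not agree modulo `im d^{k,ρ}` with a combination of terms of
grade `k` that come later in the priority of elimination. -/
def styleSpace (r : ℕ) (v : VField) (ρ : ℕ) (k : ℤ) : Submodule ℝ VField :=
  Submodule.span ℝ {e | ∃ t : Term, t.Admissible ∧ t.grade r = k ∧ e = t.field ∧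
    t.field ∉ dImage r v ρ k ⊔ Submodule.span ℝ
      {f | ∃ u : Term, u.Admissible ∧ u.grade r = k ∧ t.Before u ∧ f = u.field}}

/-- Each component `v_k` lies in the complement `C^ρ_k` to `im d^{k,ρ}` in the homogeneous part of
grade `k`. -/
def InNormalForm (r ρ : ℕ) (v : VField) : Prop :=
  ∀ k : ℤ, dImage r v ρ k ⊔ styleSpace r v ρ k = gradedL r k ∧
    Disjoint (dImage r v ρ k) (styleSpace r v ρ k) ∧
    component r k v ∈ styleSpace r v ρ k

/-! ### Near-identity changes of state and time -/

/-- `(x, y) = φ(X, Y)` is a near-identity formal change of the state variables: it is tangent to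
the identity and `φ - id` consists of terms of positive grade. -/
structure IsNearIdentity (r : ℕ) (φ : Fin 2 → Series) : Prop where
  tangent : ∀ i n, n.degree ≤ 1 →
    MvPowerSeries.coeff n (φ i) = MvPowerSeries.coeff n (MvPowerSeries.X i : Series)
  graded : ∀ i n, MvPowerSeries.coeff n (φ i - MvPowerSeries.X i) ≠ 0 →
    varWeight r i < weight r n

/-- `u` is the vector field `v` in the new variables given by `(x, y) = φ(X, Y)`, that is,
`Dφ · u = v ∘ φ`. -/
def IsPullback (φ : Fin 2 → Series) (v u : VField) : Prop :=
  ∀ i, ∑ j, u j * MvPowerSeries.pderiv ℝ j (φ i) = MvPowerSeries.subst φ (v i)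

/-- `w` is obtained from `v` by a near-identity change of state `φ` and a near-identity time
rescaling, which replaces `u` by `u + T u`. -/
def OrbitallyTransforms (r : ℕ) (v w : VField) : Prop :=
  ∃ (φ : Fin 2 → Series) (T : Series) (u : VField),
    IsNearIdentity r φ ∧ MvPowerSeries.constantCoeff T = 0 ∧ IsPullback φ v u ∧ w = u + T • u

/-- `w` is a `ρ`-th level partially extended orbital normal form of `v`. -/
def IsOrbitalNormalForm (r ρ : ℕ) (v w : VField) : Prop :=
  OrbitallyTransforms r v w ∧ InNormalForm r ρ w

/-- The first level normal form
`A^1_0 + ∑_{k ≥ r} a_k A^{-1}_k + ∑_{k ≥ s} b_k B^0_k`, i.e. the system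
`x' = ∑ a_k y^(k+1) + ∑ b_k x y^k`, `y' = -x + ∑ b_k y^(k+1)`. -/
def firstLevel (r s : ℕ) (a b : ℕ → ℝ) : VField :=
  vA 1 0 + formalSum (fun j => a (r + j) • vA (-1) (r + j)) +
    formalSum (fun j => b (s + j) • vB 0 (s + j))

end CuspNF

end

noncomputable section

namespace CuspNF

open Finsupp (single)
open MvPowerSeries (coeff X pderiv monomial subst HasSubst)

/-! ### The weight filtration -/

/-! The lowest-grade part of `firstLevel` is `lead r a`, the field L = a y^(r+1) ∂x - x ∂y of grade
r with a = a_r; the inequality r < 2s puts all B-terms above it. A near-identity change of state and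
time keeps this part, so every transformed field w also starts with L (`leading_of_conjugate`).
Because w has nothing below grade r, the kernel conditions in the domain of d^{k,r+1} are empty, and
its image consists of the fields T L + [S, L] with T and S of grade k - r (`dImage_eq`). The
(r+1)-th level is therefore a linear problem about L alone.

That problem becomes scalar through the Hamiltonian h = x^2/2 + a y^(r+2)/(r+2). The map U ↦ U(h)
(`derivHam`) has kernel the multiples of L, is onto in the weights that occur, and turns [S, L] into
-L(S(h)). Hence in grades above r a field e is removable exactly when e(h) = L(F) for some F of the
right weight. Three facts finish the linear algebra. The A-term with Hamiltonian G is removable,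
since it sends h to -L(G). Modulo the image of L on series everything reduces to powers y^m, and y^m
is itself in the image when m ≡ -1 mod r+2 (`homog_le_map_lieLead_sup`). Finally B^0_n sends h to
x^2 y^n + a y^(n+r+2), which is a nonzero multiple of y^(n+r+2) modulo the image, and for n ≢ -1 the
functional `cokerFun` shows that it is not in the image. So the B^0_n with n ≢ -1 span a complement
(`resid`), and the priority of elimination selects exactly these terms (`styleSpace_eq_resid`).

Existence: solve the homological equation grade by grade and take the formal limit (`IsApprox.step`,
`exists_conjugation`).

Shape: the linear algebra leaves every B^0_n with 2n > r, and it remains to exclude n < s. The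
A-terms of `firstLevel` preserve their own Hamiltonian H, so `firstLevel` changes H only in weight
at least 2r+4+2s. The pullback K of H is then an equally good approximate first integral of w, with
leading part h. If c_n B^0_n with n < s were the first B-term of w, then c_n B^0_n(h) would lie in
the image of L up to higher weight, which `cokerFun` forbids unless c_n = 0
(`coeff_eq_zero_of_integral`). -/

theorem weight_add (r : ℕ) (m n : Fin 2 →₀ ℕ) : weight r (m + n) = weight r m + weight r n := by
  simp only [weight, Finsupp.add_apply]; push_cast; ring

@[simp] theorem weight_zero (r : ℕ) : weight r 0 = 0 := by simp [weight]

@[simp] theorem weight_single (r : ℕ) (i : Fin 2) : weight r (single i 1) = varWeight r i := rfl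

theorem varWeight_zero (r : ℕ) : varWeight r 0 = r + 2 := by simp [varWeight, weight]

theorem varWeight_one (r : ℕ) : varWeight r 1 = 2 := by simp [varWeight, weight]

theorem weight_nonneg (r : ℕ) (n : Fin 2 →₀ ℕ) : 0 ≤ weight r n := by
  unfold weight; positivity

theorem varWeight_pos (r : ℕ) (i : Fin 2) : 0 < varWeight r i := by
  fin_cases i
  · simp [varWeight_zero]; positivity
  · simp [varWeight_one]

/-- The series all of whose monomials have weight at least `N`. -/
def filt (r : ℕ) (N : ℤ) : Submodule ℝ Series where
  carrier := {f | ∀ n, weight r n < N → coeff n f = 0}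
  add_mem' hf hg n hn := by rw [map_add, hf n hn, hg n hn, add_zero]
  zero_mem' n _ := by simp
  smul_mem' c f hf n hn := by rw [MvPowerSeries.coeff_smul, hf n hn, mul_zero]

/-- The series all of whose monomials have weight `N`. -/
def homog (r : ℕ) (N : ℤ) : Submodule ℝ Series where
  carrier := {f | ∀ n, weight r n ≠ N → coeff n f = 0}
  add_mem' hf hg n hn := by rw [map_add, hf n hn, hg n hn, add_zero]
  zero_mem' n _ := by simp
  smul_mem' c f hf n hn := by rw [MvPowerSeries.coeff_smul, hf n hn, mul_zero]

/-- The series with given coefficients. -/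
def ofCoeff (c : (Fin 2 →₀ ℕ) → ℝ) : Series := c

@[simp] theorem coeff_ofCoeff (c : (Fin 2 →₀ ℕ) → ℝ) (n : Fin 2 →₀ ℕ) :
    coeff n (ofCoeff c) = c n := rfl

theorem filt_mono {r : ℕ} {M N : ℤ} (h : M ≤ N) {f : Series} (hf : f ∈ filt r N) :
    f ∈ filt r M := fun n hn => hf n (hn.trans_le h)

theorem homog_le_filt (r : ℕ) (N : ℤ) : homog r N ≤ filt r N := fun _ hf n hn => hf n hn.ne

theorem mem_filt_of_nonpos {r : ℕ} {N : ℤ} (h : N ≤ 0) (f : Series) : f ∈ filt r N :=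
  fun n hn => absurd (weight_nonneg r n) (by omega)

theorem eq_zero_of_forall_filt {r : ℕ} {f : Series} (h : ∀ m : ℕ, f ∈ filt r m) : f = 0 := by
  ext n
  obtain ⟨m, hm⟩ := Int.eq_ofNat_of_zero_le (weight_nonneg r n)
  exact h (m + 1) n (by rw [hm]; push_cast; omega)

theorem mul_mem_filt {r : ℕ} {M N : ℤ} {f g : Series} (hf : f ∈ filt r M) (hg : g ∈ filt r N) :
    f * g ∈ filt r (M + N) := by
  intro n hn
  rw [MvPowerSeries.coeff_mul]
  refine Finset.sum_eq_zero fun p hp => ?_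
  rw [Finset.HasAntidiagonal.mem_antidiagonal] at hp
  rw [← hp, weight_add] at hn
  by_cases h : weight r p.1 < M
  · rw [hf _ h, zero_mul]
  · rw [hg _ (by omega), mul_zero]

theorem mul_mem_homog {r : ℕ} {M N : ℤ} {f g : Series} (hf : f ∈ homog r M)
    (hg : g ∈ homog r N) : f * g ∈ homog r (M + N) := by
  intro n hn
  rw [MvPowerSeries.coeff_mul]
  refine Finset.sum_eq_zero fun p hp => ?_
  rw [Finset.HasAntidiagonal.mem_antidiagonal] at hp
  rw [← hp, weight_add] at hn
  by_cases h : weight r p.1 = M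
  · rw [hg _ (by omega), mul_zero]
  · rw [hf _ h, zero_mul]

theorem mul_mem_filt' {r : ℕ} {M N K : ℤ} {f g : Series} (hf : f ∈ filt r M)
    (hg : g ∈ filt r N) (h : K ≤ M + N) : f * g ∈ filt r K :=
  filt_mono h (mul_mem_filt hf hg)

theorem pderiv_mem_filt {r : ℕ} {N : ℤ} {f : Series} (hf : f ∈ filt r N) (j : Fin 2) :
    pderiv ℝ j f ∈ filt r (N - varWeight r j) := by
  intro n hn
  rw [MvPowerSeries.coeff_pderiv, hf _ (by rw [weight_add, weight_single]; omega), zero_mul]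

theorem pderiv_mem_homog {r : ℕ} {N : ℤ} {f : Series} (hf : f ∈ homog r N) (j : Fin 2) :
    pderiv ℝ j f ∈ homog r (N - varWeight r j) := by
  intro n hn
  rw [MvPowerSeries.coeff_pderiv, hf _ (by rw [weight_add, weight_single]; omega), zero_mul]

theorem monomial_mem_homog (r : ℕ) (n : Fin 2 →₀ ℕ) (c : ℝ) :
    monomial n c ∈ homog r (weight r n) := fun m hm =>
  MvPowerSeries.coeff_monomial_ne (fun h => hm (by rw [h])) c

theorem X_mem_homog (r : ℕ) (i : Fin 2) : (X i : Series) ∈ homog r (varWeight r i) :=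
  monomial_mem_homog r _ 1

theorem X_mem_filt (r : ℕ) (i : Fin 2) : (X i : Series) ∈ filt r (varWeight r i) :=
  homog_le_filt _ _ (X_mem_homog r i)

theorem one_mem_filt (r : ℕ) : (1 : Series) ∈ filt r 0 := mem_filt_of_nonpos le_rfl _

theorem pow_mem_filt {r : ℕ} {N : ℤ} {f : Series} (hf : f ∈ filt r N) (k : ℕ) :
    f ^ k ∈ filt r (k * N) := by
  induction k with
  | zero => simpa using one_mem_filt r
  | succ k ih =>
    rw [pow_succ]
    exact mul_mem_filt' ih hf (by push_cast; linarith)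

/-! ### Reduction to monomials -/

theorem finite_weight_lt (r : ℕ) (N : ℤ) : {n : Fin 2 →₀ ℕ | weight r n < N}.Finite := by
  refine (Set.finite_Iic (single 0 N.toNat + single 1 N.toNat : Fin 2 →₀ ℕ)).subset ?_
  intro n hn i
  have h0 : 0 ≤ (r : ℤ) * n 0 := by positivity
  simp only [Set.mem_ofPred_eq, weight] at hn
  fin_cases i <;> simp <;> nlinarith [Int.self_le_toNat N]

theorem exists_sum_monomial (r : ℕ) (N : ℤ) (f : Series) :
    ∃ s : Finset (Fin 2 →₀ ℕ), f - ∑ n ∈ s, coeff n f • monomial n (1 : ℝ) ∈ filt r N := by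
  refine ⟨(finite_weight_lt r N).toFinset, fun n hn => ?_⟩
  classical
  rw [map_sub, map_sum, Finset.sum_eq_single n]
  · simp
  · intro b _ hb
    rw [MvPowerSeries.coeff_smul, MvPowerSeries.coeff_monomial_ne hb.symm, mul_zero]
  · intro h
    exact absurd ((finite_weight_lt r N).mem_toFinset.2 hn) h

/-- This stands in for continuity. If `L` shifts weights by at least some fixed, possibly negative,
`c`, then `f` can be truncated so far out that the tail is harmless, and the sharper shift `d` need
only be checked on monomials. -/
theorem linearMap_mem_filt {r : ℕ} (L : Series →ₗ[ℝ] Series) (c d : ℤ)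
    (hL : ∀ M f, f ∈ filt r M → L f ∈ filt r (M + c))
    (hm : ∀ n, L (monomial n 1) ∈ filt r (weight r n + d)) {N : ℤ} {f : Series}
    (hf : f ∈ filt r N) : L f ∈ filt r (N + d) := by
  obtain ⟨s, hs⟩ := exists_sum_monomial r (N + d - c) f
  have h1 := hL _ _ hs
  rw [map_sub, sub_add_cancel] at h1
  have h2 : L (∑ n ∈ s, coeff n f • monomial n (1 : ℝ)) ∈ filt r (N + d) := by
    rw [map_sum]
    refine Submodule.sum_mem _ fun n _ => ?_
    rw [map_smul]
    by_cases h : weight r n < N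
    · rw [hf n h, zero_smul]; exact Submodule.zero_mem _
    · exact Submodule.smul_mem _ _ (filt_mono (by omega) (hm n))
  simpa using Submodule.add_mem _ h1 h2

theorem exponent_induction {P : (Fin 2 →₀ ℕ) → Prop} (h0 : P 0)
    (h : ∀ n i, P n → P (n + single i 1)) (n : Fin 2 →₀ ℕ) : P n := by
  have key : ∀ (i : Fin 2) (k : ℕ) (m : Fin 2 →₀ ℕ), P m → P (m + single i k) := by
    intro i k
    induction k with
    | zero => intro m hm; simpa using hm
    | succ k ih =>
      intro m hm
      rw [Finsupp.single_add, ← add_assoc]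
      exact h _ _ (ih m hm)
  have : n = 0 + single 0 (n 0) + single 1 (n 1) := by
    ext i; fin_cases i <;> simp
  rw [this]
  exact key _ _ _ (key _ _ _ h0)

theorem monomial_add_single (n : Fin 2 →₀ ℕ) (i : Fin 2) :
    (monomial (n + single i 1) 1 : Series) = monomial n 1 * X i := by
  rw [MvPowerSeries.X_def, MvPowerSeries.monomial_mul_monomial, one_mul]

/-! ### Substitution -/

/-- The tuples of series that may be substituted for the variables without lowering weights. -/
def Adm (r : ℕ) (φ : Fin 2 → Series) : Prop := ∀ i, φ i ∈ filt r (varWeight r i)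

theorem Adm.hasSubst {r : ℕ} {φ : Fin 2 → Series} (h : Adm r φ) : HasSubst φ :=
  MvPowerSeries.hasSubst_of_constantCoeff_zero fun i =>
    h i 0 (by simpa using varWeight_pos r i)

theorem adm_X (r : ℕ) : Adm r X := X_mem_filt r

theorem adm_of_sub_mem {r : ℕ} {φ : Fin 2 → Series}
    (h : ∀ i, φ i - X i ∈ filt r (varWeight r i + 1)) : Adm r φ := fun i => by
  simpa using Submodule.add_mem _ (filt_mono (by omega) (h i)) (X_mem_filt r i)

theorem Adm.subst_mem {r : ℕ} {φ : Fin 2 → Series} (h : Adm r φ) {N : ℤ} {f : Series}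
    (hf : f ∈ filt r N) : subst φ f ∈ filt r N := by
  intro e he
  rw [MvPowerSeries.coeff_subst h.hasSubst]
  refine finsum_eq_zero_of_forall_eq_zero fun d => ?_
  by_cases hd : weight r d < N
  · rw [hf d hd, zero_smul]
  · have : (d.prod fun s e => φ s ^ e) ∈ filt r (weight r d) := by
      rw [Finsupp.prod_fintype _ _ (by simp), Fin.prod_univ_two]
      refine mul_mem_filt' (pow_mem_filt (h 0) _) (pow_mem_filt (h 1) _) ?_
      rw [varWeight_zero, varWeight_one, weight]
      linarith
    rw [this e (by omega), smul_zero]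

/-- Substitution as a linear map. -/
def substLin {φ : Fin 2 → Series} (h : HasSubst φ) : Series →ₗ[ℝ] Series :=
  (MvPowerSeries.substAlgHom (R := ℝ) h).toLinearMap

@[simp] theorem substLin_apply {φ : Fin 2 → Series} (h : HasSubst φ) (f : Series) :
    substLin h f = subst φ f := by
  simp [substLin]

theorem subst_one {φ : Fin 2 → Series} (h : HasSubst φ) : subst φ (1 : Series) = 1 := by
  rw [← MvPowerSeries.coe_substAlgHom (R := ℝ) h, map_one]

theorem subst_zero_right {φ : Fin 2 → Series} (h : HasSubst φ) : subst φ (0 : Series) = 0 := by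
  rw [← substLin_apply h, map_zero]

/-- The chain rule. -/
theorem pderiv_subst {r : ℕ} {φ : Fin 2 → Series} (h : Adm r φ) (j : Fin 2) (f : Series) :
    pderiv ℝ j (subst φ f) = ∑ i, subst φ (pderiv ℝ i f) * pderiv ℝ j (φ i) := by
  have hs := h.hasSubst
  -- Both sides are linear in `f` and lower weights by a bounded amount; their difference vanishes
  -- on monomials by the product rule, hence everywhere.
  let L : Series →ₗ[ℝ] Series :=
    (pderiv ℝ j).toLinearMap ∘ₗ substLin hs -
      ∑ i, LinearMap.mulRight ℝ (pderiv ℝ j (φ i)) ∘ₗ substLin hs ∘ₗ (pderiv ℝ i).toLinearMap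
  have hLf : ∀ f, L f = pderiv ℝ j (subst φ f) -
      ∑ i, subst φ (pderiv ℝ i f) * pderiv ℝ j (φ i) := fun f => by
    simp [L]
  have h1 : ∀ M f, f ∈ filt r M → L f ∈ filt r (M + -varWeight r j) := by
    intro M f hf
    rw [hLf]
    refine Submodule.sub_mem _ (pderiv_mem_filt (h.subst_mem hf) j)
      (Submodule.sum_mem _ fun i _ => mul_mem_filt' (h.subst_mem (pderiv_mem_filt hf i))
        (pderiv_mem_filt (h i) j) (by omega))
  have h2 : ∀ n, L (monomial n 1) = 0 := by
    intro n
    induction n using exponent_induction with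
    | h0 =>
      rw [hLf, MvPowerSeries.monomial_zero_one, subst_one hs]
      simp [Derivation.map_one_eq_zero, subst_zero_right hs]
    | h n i ih =>
      rw [hLf, sub_eq_zero] at ih ⊢
      rw [monomial_add_single, MvPowerSeries.subst_mul hs, MvPowerSeries.subst_X hs,
        Derivation.leibniz, ih]
      simp only [Fin.sum_univ_two, Derivation.leibniz, smul_eq_mul, MvPowerSeries.subst_mul hs,
        MvPowerSeries.subst_add hs, MvPowerSeries.subst_X hs]
      fin_cases i
      · simp [subst_one hs, subst_zero_right hs, MvPowerSeries.pderiv_X_of_ne]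
        ring
      · simp [subst_one hs, subst_zero_right hs, MvPowerSeries.pderiv_X_of_ne]
        ring
  rw [← sub_eq_zero, ← hLf]
  refine eq_zero_of_forall_filt (r := r) fun m => ?_
  have := linearMap_mem_filt (r := r) L _ (m : ℤ) h1
    (fun n => by rw [h2]; exact Submodule.zero_mem _) (mem_filt_of_nonpos le_rfl f)
  simpa using this

theorem subst_sub_subst_mem {r : ℕ} {φ ψ : Fin 2 → Series} (hφ : Adm r φ) (hψ : Adm r ψ) {d : ℤ}
    (h : ∀ i, ψ i - φ i ∈ filt r (varWeight r i + d)) {N : ℤ} {f : Series}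
    (hf : f ∈ filt r N) : subst ψ f - subst φ f ∈ filt r (N + d) := by
  let L : Series →ₗ[ℝ] Series := substLin hψ.hasSubst - substLin hφ.hasSubst
  have hLf : ∀ f, L f = subst ψ f - subst φ f := fun f => by simp [L]
  rw [← hLf]
  refine linearMap_mem_filt L 0 d (fun M f hf => ?_) (fun n => ?_) hf
  · rw [hLf, add_zero]
    exact Submodule.sub_mem _ (hψ.subst_mem hf) (hφ.subst_mem hf)
  · induction n using exponent_induction with
    | h0 =>
      rw [hLf, MvPowerSeries.monomial_zero_one, subst_one hφ.hasSubst, subst_one hψ.hasSubst,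
        sub_self]
      exact Submodule.zero_mem _
    | h n i ih =>
      rw [hLf] at ih ⊢
      have hm := homog_le_filt _ _ (monomial_mem_homog r n 1)
      rw [monomial_add_single, MvPowerSeries.subst_mul hφ.hasSubst,
        MvPowerSeries.subst_mul hψ.hasSubst, MvPowerSeries.subst_X hφ.hasSubst,
        MvPowerSeries.subst_X hψ.hasSubst, weight_add, weight_single,
        show ∀ p q : Series, p * ψ i - q * φ i = (p - q) * ψ i + q * (ψ i - φ i) by
          intros; ring]
      exact Submodule.add_mem _ (mul_mem_filt' ih (hψ i) (by omega))
        (mul_mem_filt' (hφ.subst_mem hm) (h i) (by omega))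

theorem subst_sub_self_mem {r : ℕ} {φ : Fin 2 → Series}
    (h : ∀ i, φ i - X i ∈ filt r (varWeight r i + 1)) {N : ℤ} {f : Series}
    (hf : f ∈ filt r N) : subst φ f - f ∈ filt r (N + 1) := by
  have := subst_sub_subst_mem (adm_X r) (adm_of_sub_mem h) h hf
  rwa [MvPowerSeries.subst_self] at this

/-- Taylor expansion to first order. The derivatives of `f` may be taken at the identity instead of
at `φ`, because `φ` differs from the identity by a gain of one in weight, which is the accuracy
claimed. -/
theorem subst_add_sub_mem {r : ℕ} {φ S : Fin 2 → Series} {d : ℤ} (hd : 1 ≤ d)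
    (hφ : ∀ i, φ i - X i ∈ filt r (varWeight r i + 1))
    (hS : ∀ i, S i ∈ filt r (varWeight r i + d)) {N : ℤ} {f : Series} (hf : f ∈ filt r N) :
    subst (φ + S) f - subst φ f - ∑ i, S i * pderiv ℝ i f ∈ filt r (N + (d + 1)) := by
  have hφS : ∀ i, (φ + S) i - X i ∈ filt r (varWeight r i + 1) := fun i => by
    rw [Pi.add_apply, add_sub_right_comm]
    exact Submodule.add_mem _ (hφ i) (filt_mono (by omega) (hS i))
  have aφ := adm_of_sub_mem hφ
  have aψ := adm_of_sub_mem hφS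
  let L : Series →ₗ[ℝ] Series := substLin aψ.hasSubst - substLin aφ.hasSubst -
      ∑ i, LinearMap.mulLeft ℝ (S i) ∘ₗ (pderiv ℝ i).toLinearMap
  have hLf : ∀ f, L f = subst (φ + S) f - subst φ f - ∑ i, S i * pderiv ℝ i f :=
    fun f => by simp [L]
  rw [← hLf]
  refine linearMap_mem_filt L 0 _ (fun M f hf => ?_) (fun n => ?_) hf
  · rw [hLf, add_zero]
    exact Submodule.sub_mem _ (Submodule.sub_mem _ (aψ.subst_mem hf) (aφ.subst_mem hf))
      (Submodule.sum_mem _ fun i _ => mul_mem_filt' (hS i) (pderiv_mem_filt hf i) (by omega))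
  · induction n using exponent_induction with
    | h0 =>
      rw [hLf, MvPowerSeries.monomial_zero_one, subst_one aφ.hasSubst, subst_one aψ.hasSubst]
      simp [Derivation.map_one_eq_zero]
    | h n i ih =>
      rw [hLf] at ih ⊢
      have hm := homog_le_filt _ _ (monomial_mem_homog r n 1)
      -- Each of the three products gains d + 1: the inductive remainder, then (gain 1 from `φ`)
      -- times (gain d from `S`), then (gain d) times (gain 1).
      have e : subst (φ + S) (monomial (n + single i 1) (1 : ℝ)) -
          subst φ (monomial (n + single i 1) (1 : ℝ)) -
          ∑ k, S k * pderiv ℝ k (monomial (n + single i 1) (1 : ℝ)) =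
          (subst (φ + S) (monomial n (1 : ℝ)) - subst φ (monomial n (1 : ℝ)) -
            ∑ k, S k * pderiv ℝ k (monomial n (1 : ℝ))) * (φ + S) i +
          (subst φ (monomial n (1 : ℝ)) - monomial n (1 : ℝ)) * S i +
          (∑ k, S k * pderiv ℝ k (monomial n (1 : ℝ))) * ((φ + S) i - X i) := by
        rw [monomial_add_single, MvPowerSeries.subst_mul aφ.hasSubst,
          MvPowerSeries.subst_mul aψ.hasSubst, MvPowerSeries.subst_X aφ.hasSubst,
          MvPowerSeries.subst_X aψ.hasSubst]
        simp only [Fin.sum_univ_two, Derivation.leibniz, smul_eq_mul, Pi.add_apply]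
        fin_cases i
        · simp [MvPowerSeries.pderiv_X_of_ne]
          ring
        · simp [MvPowerSeries.pderiv_X_of_ne]
          ring
      rw [e, weight_add, weight_single]
      refine Submodule.add_mem _ (Submodule.add_mem _ (mul_mem_filt' ih (aψ i) (by omega))
        (mul_mem_filt' (subst_sub_self_mem hφ hm) (hS i) (by omega)))
        (mul_mem_filt' (M := weight r n + d) (Submodule.sum_mem _ fun k _ =>
          mul_mem_filt' (hS k) (pderiv_mem_filt hm k) (by omega)) (hφS i) (by omega))

/-! ### Formal limits in the weight filtration. -/

theorem exists_filt_limit {r : ℕ} {A : ℤ} (g : ℕ → Series)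
    (hg : ∀ m : ℕ, g (m + 1) - g m ∈ filt r (A + m)) :
    ∃ G : Series, (∀ m : ℕ, G - g m ∈ filt r (A + m)) ∧
      ∀ n c, (∀ m, coeff n (g m) = c) → coeff n G = c := by
  have hadd : ∀ m k : ℕ, g (m + k) - g m ∈ filt r (A + m) := by
    intro m k
    induction k with
    | zero => simp
    | succ k ih =>
      have := Submodule.add_mem _ (filt_mono (M := A + m) (by push_cast; omega) (hg (m + k))) ih
      rwa [sub_add_sub_cancel] at this
  -- The coefficient at `n` is constant in the sequence from index weight + 1 - A on, so it is read
  -- off there.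
  refine ⟨ofCoeff fun n => coeff n (g (weight r n + 1 - A).toNat), fun m n hn => ?_,
    fun n c h => h _⟩
  rw [map_sub, coeff_ofCoeff, ← map_sub, ← neg_sub, map_neg, neg_eq_zero]
  obtain ⟨k, hk⟩ := Nat.exists_eq_add_of_le (show (weight r n + 1 - A).toNat ≤ m by omega)
  rw [hk]
  exact hadd _ k n (by omega)

/-! ### Monomials -/

/-- The exponent of `x ^ i * y ^ j`. -/
def expo (i j : ℕ) : Fin 2 →₀ ℕ := single 0 i + single 1 j

@[simp] theorem expo_zero (i j : ℕ) : expo i j 0 = i := by simp [expo]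

@[simp] theorem expo_one (i j : ℕ) : expo i j 1 = j := by simp [expo]

theorem eq_expo (n : Fin 2 →₀ ℕ) : n = expo (n 0) (n 1) := by
  ext i; fin_cases i <;> simp

theorem expo_le_expo {i j p q : ℕ} : expo p q ≤ expo i j ↔ p ≤ i ∧ q ≤ j := by
  refine ⟨fun h => ⟨by simpa using h 0, by simpa using h 1⟩, fun h i => ?_⟩
  fin_cases i
  · simpa using h.1
  · simpa using h.2

theorem expo_sub_expo (i j p q : ℕ) : expo i j - expo p q = expo (i - p) (j - q) := by
  ext k; fin_cases k <;> simp

theorem expo_inj {i j p q : ℕ} : expo p q = expo i j ↔ p = i ∧ q = j := by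
  refine ⟨fun h => ⟨by simpa using DFunLike.congr_fun h 0, by simpa using DFunLike.congr_fun h 1⟩,
    fun h => by rw [h.1, h.2]⟩

theorem weight_expo (r i j : ℕ) : weight r (expo i j) = (r + 2) * i + 2 * j := by
  simp [weight]

theorem mono_eq (i j : ℕ) : mono i j = monomial (expo i j) 1 := by
  rw [mono, MvPowerSeries.X_pow_eq, MvPowerSeries.X_pow_eq, MvPowerSeries.monomial_mul_monomial,
    one_mul, expo]

theorem coeff_mono (i j p q : ℕ) :
    coeff (expo i j) (mono p q) = if p = i ∧ q = j then 1 else 0 := by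
  classical
  rw [mono_eq, MvPowerSeries.coeff_monomial]
  simp only [expo_inj, eq_comm]

theorem coeff_mono_mul (i j p q : ℕ) (f : Series) :
    coeff (expo i j) (mono p q * f) =
      if p ≤ i ∧ q ≤ j then coeff (expo (i - p) (j - q)) f else 0 := by
  classical
  rw [mono_eq, MvPowerSeries.coeff_monomial_mul, expo_sub_expo, one_mul]
  simp only [expo_le_expo]

theorem series_ext {f g : Series} (h : ∀ i j, coeff (expo i j) f = coeff (expo i j) g) :
    f = g := by
  ext n
  rw [eq_expo n]
  exact h _ _

theorem mono_mul_mono (i j p q : ℕ) : mono i j * mono p q = mono (i + p) (j + q) := by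
  simp only [mono, pow_add]; ring

theorem mono_mem_homog' (r i j : ℕ) : mono i j ∈ homog r ((r + 2) * i + 2 * j) := by
  rw [mono_eq, ← weight_expo]
  exact monomial_mem_homog r _ 1

theorem mono_mem_homog {r i j : ℕ} {N : ℤ} (h : ((r : ℤ) + 2) * i + 2 * j = N) :
    mono i j ∈ homog r N := h ▸ mono_mem_homog' r i j

theorem homog_congr {r : ℕ} {M N : ℤ} (h : M = N) {f : Series} (hf : f ∈ homog r M) :
    f ∈ homog r N := h ▸ hf

theorem mono_zero_zero : mono 0 0 = 1 := by simp [mono]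

theorem pderiv_zero_mono (p q : ℕ) : pderiv ℝ 0 (mono p q) = (p : ℝ) • mono (p - 1) q := by
  simp only [mono, Derivation.leibniz, Derivation.leibniz_pow, MvPowerSeries.pderiv_X_self,
    MvPowerSeries.pderiv_X_of_ne (R := ℝ) (show (1 : Fin 2) ≠ 0 by decide)]
  simp [Algebra.smul_def]
  ring1

theorem pderiv_one_mono (p q : ℕ) : pderiv ℝ 1 (mono p q) = (q : ℝ) • mono p (q - 1) := by
  simp only [mono, Derivation.leibniz, Derivation.leibniz_pow, MvPowerSeries.pderiv_X_self,
    MvPowerSeries.pderiv_X_of_ne (R := ℝ) (show (0 : Fin 2) ≠ 1 by decide)]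
  simp [Algebra.smul_def]
  ring1

theorem homog_le_span (r : ℕ) (N : ℤ) :
    homog r N ≤ Submodule.span ℝ {f | ∃ i j : ℕ, ((r : ℤ) + 2) * i + 2 * j = N ∧ f = mono i j} := by
  intro f hf
  obtain ⟨s, hs⟩ := exists_sum_monomial r (N + 1) f
  have h0 : f - ∑ n ∈ s, coeff n f • monomial n (1 : ℝ) ∈ homog r N := by
    refine Submodule.sub_mem _ hf (Submodule.sum_mem _ fun n _ => ?_)
    by_cases h : weight r n = N
    · exact Submodule.smul_mem _ _ (h ▸ monomial_mem_homog r n 1)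
    · rw [hf n h, zero_smul]; exact Submodule.zero_mem _
  have h1 : f - ∑ n ∈ s, coeff n f • monomial n (1 : ℝ) = 0 := by
    ext n
    by_cases h : weight r n = N
    · exact hs n (by omega)
    · exact h0 n h
  rw [sub_eq_zero.1 h1]
  refine Submodule.sum_mem _ fun n _ => ?_
  by_cases h : weight r n = N
  · refine Submodule.smul_mem _ _ (Submodule.subset_span ⟨n 0, n 1, ?_, ?_⟩)
    · rw [← h, weight]
    · rw [mono_eq, ← eq_expo]
  · rw [hf n h, zero_smul]; exact Submodule.zero_mem _

/-! ### The leading field `a y ^ (r + 1) ∂/∂x - x ∂/∂y` -/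

/-- The Hamiltonian vector field `a y ^ (r + 1) ∂/∂x - x ∂/∂y`. -/
def lead (r : ℕ) (a : ℝ) : VField := ![a • mono 0 (r + 1), -mono 1 0]

/-- The derivative of a series along `lead r a`. -/
def lieLead (r : ℕ) (a : ℝ) : Series →ₗ[ℝ] Series :=
  LinearMap.mulLeft ℝ (a • mono 0 (r + 1)) ∘ₗ (pderiv ℝ 0).toLinearMap -
    LinearMap.mulLeft ℝ (mono 1 0) ∘ₗ (pderiv ℝ 1).toLinearMap

/-- The derivative of the Hamiltonian `x ^ 2 / 2 + a y ^ (r + 2) / (r + 2)` along a field. -/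
def derivHam (r : ℕ) (a : ℝ) : VField →ₗ[ℝ] Series :=
  LinearMap.mulLeft ℝ (mono 1 0) ∘ₗ LinearMap.proj 0 +
    LinearMap.mulLeft ℝ (a • mono 0 (r + 1)) ∘ₗ LinearMap.proj 1

theorem lieLead_apply (r : ℕ) (a : ℝ) (f : Series) :
    lieLead r a f = (a • mono 0 (r + 1)) * pderiv ℝ 0 f - mono 1 0 * pderiv ℝ 1 f := rfl

theorem derivHam_apply (r : ℕ) (a : ℝ) (U : VField) :
    derivHam r a U = mono 1 0 * U 0 + (a • mono 0 (r + 1)) * U 1 := rfl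

theorem bracketRight_apply (w v : VField) (i : Fin 2) :
    bracketRight w v i =
      ∑ j, (v j * pderiv ℝ j (w i) - w j * pderiv ℝ j (v i)) := rfl

theorem bracketRight_self (w : VField) : bracketRight w w = 0 := by
  funext i
  simp [bracketRight_apply]

theorem derivHam_smul_lead (r : ℕ) (a : ℝ) (f : Series) : derivHam r a (f • lead r a) = 0 := by
  simp [derivHam_apply, lead, MvPowerSeries.smul_eq_C_mul]
  ring1

/-- [S, L](h) = S(L(h)) - L(S(h)), and L(h) = 0. This turns the homological equation for fields into
one for series. -/
theorem derivHam_bracket_lead (r : ℕ) (a : ℝ) (S : VField) :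
    derivHam r a (bracketRight (lead r a) S) = -lieLead r a (derivHam r a S) := by
  simp only [derivHam_apply, lieLead_apply, bracketRight_apply, Fin.sum_univ_two, map_add,
    Derivation.leibniz, smul_eq_mul, lead, Matrix.cons_val_zero, Matrix.cons_val_one, map_neg,
    pderiv_zero_mono, pderiv_one_mono, MvPowerSeries.smul_eq_C_mul]
  simp [mono_zero_zero]
  ring1

theorem lieLead_mono (r : ℕ) (a : ℝ) (p q : ℕ) :
    lieLead r a (mono p q) =
      (a * p) • mono (p - 1) (q + (r + 1)) - (q : ℝ) • mono (p + 1) (q - 1) := by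
  rw [lieLead_apply, pderiv_zero_mono, pderiv_one_mono, mul_smul_comm, smul_mul_assoc,
    mono_mul_mono, mul_smul_comm, mono_mul_mono, smul_smul, mul_comm a, zero_add, zero_add,
    add_comm 1 p, add_comm (r + 1) q]

theorem lieLead_mul (r : ℕ) (a : ℝ) (f g : Series) :
    lieLead r a (f * g) = f * lieLead r a g + lieLead r a f * g := by
  simp only [lieLead_apply, Derivation.leibniz, smul_eq_mul]
  ring1

/-! ### The first integral of the leading field and the image of `lieLead`. -/

/-- The Hamiltonian of `lead r a`. -/
def ham (r : ℕ) (a : ℝ) : Series := (1 / 2 : ℝ) • mono 2 0 + (a / (r + 2)) • mono 0 (r + 2)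

theorem lieLead_ham (r : ℕ) (a : ℝ) : lieLead r a (ham r a) = 0 := by
  have h : (r : ℝ) + 2 ≠ 0 := by positivity
  simp only [ham, map_add, map_smul, lieLead_mono]
  norm_num
  rw [smul_smul, smul_smul, ← sub_eq_add_neg, sub_eq_zero]
  congr 1
  field_simp

theorem ham_mem_homog (r : ℕ) (a : ℝ) : ham r a ∈ homog r (2 * r + 4) :=
  Submodule.add_mem _ (Submodule.smul_mem _ _ (mono_mem_homog (by push_cast; ring)))
    (Submodule.smul_mem _ _ (mono_mem_homog (by push_cast; ring)))

/-- Induction in steps of r+2, starting from L(x) = a y^(r+1). If L(F) = y^m then L(hF) = h y^m,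
which contains y^(m+r+2) and x^2 y^m; a multiple of L(x y^(m+1)) cancels the latter. -/
theorem mono_mem_map_lieLead (r : ℕ) {a : ℝ} (ha : a ≠ 0) (t : ℕ) :
    ∃ F ∈ homog r (2 * (r + 1 + t * (r + 2)) - r), lieLead r a F = mono 0 (r + 1 + t * (r + 2)) := by
  induction t with
  | zero =>
    refine ⟨a⁻¹ • mono 1 0, Submodule.smul_mem _ _ (mono_mem_homog (by push_cast; ring)), ?_⟩
    rw [map_smul, lieLead_mono]
    simp [smul_smul, ha]
  | succ t ih =>
    obtain ⟨F, hF, e⟩ := ih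
    set m := r + 1 + t * (r + 2) with hm
    have hm' : r + 1 + (t + 1) * (r + 2) = m + (r + 2) := by rw [hm]; ring
    have hmZ : (m : ℤ) = r + 1 + t * (r + 2) := by rw [hm]; push_cast; ring1
    -- The coefficient of y^(m+r+2) left after x^2 y^m cancels; both summands have the sign of `a`,
    -- so it cannot vanish.
    set c : ℝ := a / (2 * (m + 1)) + a / (r + 2) with hc
    have hc0 : c ≠ 0 := by
      have : c = a * (1 / (2 * (m + 1)) + 1 / (r + 2)) := by rw [hc]; ring
      rw [this]
      exact mul_ne_zero ha (by positivity)
    refine ⟨c⁻¹ • (ham r a * F + (1 / (2 * ((m : ℝ) + 1))) • mono 1 (m + 1)),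
      Submodule.smul_mem _ _ (Submodule.add_mem _ ?_ (Submodule.smul_mem _ _ (mono_mem_homog ?_))),
      ?_⟩
    · have h := mul_mem_homog (ham_mem_homog r a) hF
      exact homog_congr (by push_cast; ring) h
    · push_cast; rw [hmZ]; ring
    · rw [map_smul, map_add, lieLead_mul, lieLead_ham, zero_mul, add_zero, e, map_smul,
        lieLead_mono, hm', ham, add_mul, smul_mul_assoc, smul_mul_assoc, mono_mul_mono,
        mono_mul_mono, inv_smul_eq_iff₀ hc0, hc]
      have e1 : r + 2 + m = m + (r + 2) := by omega
      have e2 : m + 1 + (r + 1) = m + (r + 2) := by omega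
      simp only [e1, e2, smul_sub, smul_smul, add_smul, zero_add, add_zero, Nat.add_sub_cancel,
        Nat.sub_self, Nat.cast_one, mul_one, Nat.cast_add, one_add_one_eq_two]
      rw [← add_smul, smul_smul, show 1 / (2 * ((m : ℝ) + 1)) * (m + 1) = 1 / 2 by field_simp,
        one_div_mul_eq_div]
      abel

theorem not_modEq_or (r m : ℕ) :
    ¬ (m : ℤ) ≡ -1 [ZMOD ((r : ℤ) + 2)] ∨ ∃ t : ℕ, m = r + 1 + t * (r + 2) := by
  by_cases h : (m : ℤ) ≡ -1 [ZMOD ((r : ℤ) + 2)]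
  · right
    obtain ⟨t, ht⟩ := h.symm.dvd
    have hr : (0 : ℤ) < r + 2 := by positivity
    have ht1 : 1 ≤ t := by
      by_contra hlt
      have : ((r : ℤ) + 2) * t ≤ 0 := mul_nonpos_of_nonneg_of_nonpos hr.le (by omega)
      omega
    obtain ⟨u, hu⟩ := Int.eq_ofNat_of_zero_le (show 0 ≤ t - 1 by omega)
    obtain rfl : t = u + 1 := by omega
    refine ⟨u, ?_⟩
    zify
    linarith
  · exact Or.inl h

/-- The cokernel of `lieLead` is spanned by the powers of `y`. -/
theorem homog_le_map_lieLead_sup (r : ℕ) {a : ℝ} (ha : a ≠ 0) (N : ℤ) :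
    homog r N ≤ (homog r (N - r)).map (lieLead r a) ⊔ Submodule.span ℝ
      {e | ∃ m : ℕ, 2 * (m : ℤ) = N ∧ ¬ (m : ℤ) ≡ -1 [ZMOD ((r : ℤ) + 2)] ∧ e = mono 0 m} := by
  refine (homog_le_span r N).trans (Submodule.span_le.2 ?_)
  rintro _ ⟨p, q, h, rfl⟩
  induction p using Nat.strong_induction_on generalizing q with
  | _ p ih =>
    match p with
    | 0 =>
      rcases not_modEq_or r q with hq | ⟨t, rfl⟩
      · exact Submodule.mem_sup_right (Submodule.subset_span ⟨q, by rw [← h]; simp, hq, rfl⟩)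
      · obtain ⟨F, hF, e⟩ := mono_mem_map_lieLead r ha t
        refine Submodule.mem_sup_left ⟨F, ?_, e⟩
        exact homog_congr (by rw [← h]; push_cast; ring) hF
    | 1 =>
      refine Submodule.mem_sup_left ⟨-((1 / ((q : ℝ) + 1)) • mono 0 (q + 1)),
        Submodule.neg_mem _ (Submodule.smul_mem _ _ (mono_mem_homog ?_)), ?_⟩
      · rw [← h]; push_cast; ring1
      · have : (q : ℝ) + 1 ≠ 0 := by positivity
        rw [map_neg, map_smul, lieLead_mono]
        simp [smul_smul, this]
    | p + 2 =>
      have hq : (q : ℝ) + 1 ≠ 0 := by positivity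
      -- Applying L to x^(p+1) y^(q+1) trades x^2 for a multiple of y^(r+2); repeated, this leaves
      -- x-exponent 0 or 1, and x y^q is itself a multiple of L(y^(q+1)).
      have e : mono (p + 2) q = (1 / ((q : ℝ) + 1)) • ((a * ((p : ℝ) + 1)) • mono p (q + (r + 2)) -
          lieLead r a (mono (p + 1) (q + 1))) := by
        rw [lieLead_mono, show q + 1 + (r + 1) = q + (r + 2) by ring]
        simp [smul_smul, hq]
      rw [e]
      refine Submodule.smul_mem _ _ (Submodule.sub_mem _ (Submodule.smul_mem _ _
        (ih p (by omega) _ ?_)) (Submodule.mem_sup_left ⟨_, mono_mem_homog ?_, rfl⟩))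
      · rw [← h]; push_cast; ring1
      · rw [← h]; push_cast; ring1

/-! ### A functional that vanishes on the image of `lieLead` -/

/-- The coefficients of the functional `cokerFun`. -/
def cokerCoeff (r : ℕ) (a : ℝ) (m : ℕ) : ℕ → ℝ
  | 0 => 1
  | i + 1 => (2 * i + 1) * a * cokerCoeff r a m i / (m + 1 - (i + 1) * (r + 2))

/-- A functional on series of weight `2 m` that vanishes on the image of `lieLead`. -/
def cokerFun (r : ℕ) (a : ℝ) (m : ℕ) : Series →ₗ[ℝ] ℝ :=
  ∑ i ∈ Finset.range (m + 1), (if i * (r + 2) ≤ m then cokerCoeff r a m i else 0) •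
    coeff (expo (2 * i) (m - i * (r + 2)))

theorem cokerFun_apply (r : ℕ) (a : ℝ) (m : ℕ) (f : Series) :
    cokerFun r a m f = ∑ i ∈ Finset.range (m + 1),
      (if i * (r + 2) ≤ m then cokerCoeff r a m i else 0) *
        coeff (expo (2 * i) (m - i * (r + 2))) f := by
  simp only [cokerFun, LinearMap.sum_apply, LinearMap.smul_apply, smul_eq_mul]

theorem coeff_lieLead (r : ℕ) (a : ℝ) (f : Series) (i j : ℕ) :
    coeff (expo i j) (lieLead r a f) =
      (if r + 1 ≤ j then a * ((i + 1) * coeff (expo (i + 1) (j - (r + 1))) f) else 0) -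
        (if 1 ≤ i then (j + 1) * coeff (expo (i - 1) (j + 1)) f else 0) := by
  have e0 : ∀ i j, expo i j + single 0 1 = expo (i + 1) j := fun i j => by
    ext k; fin_cases k <;> simp
  have e1 : ∀ i j, expo i j + single 1 1 = expo i (j + 1) := fun i j => by
    ext k; fin_cases k <;> simp
  rw [lieLead_apply, map_sub, smul_mul_assoc, MvPowerSeries.coeff_smul, coeff_mono_mul,
    coeff_mono_mul]
  simp only [MvPowerSeries.coeff_pderiv, e0, e1, expo_zero, expo_one, zero_le, true_and, and_true,
    Nat.sub_zero]
  congr 1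
  · split_ifs
    · ring
    · ring
  · split_ifs
    · ring
    · rfl

/-- The recursion for `cokerCoeff` is the condition that the two terms of L(x^(2i+1) y^j), with j =
m + 1 - (i+1)(r+2), cancel. Its denominator is j, which is never zero exactly because m ≢ -1 mod
r+2. -/
theorem cokerFun_lieLead (r : ℕ) (a : ℝ) {m : ℕ} (hm : ¬ (m : ℤ) ≡ -1 [ZMOD ((r : ℤ) + 2)])
    (f : Series) : cokerFun r a m (lieLead r a f) = 0 := by
  have hne : ∀ i : ℕ, (i + 1) * (r + 2) ≠ m + 1 := by
    intro i hi
    refine hm (Int.modEq_iff_dvd.2 ⟨-((i : ℤ) + 1), ?_⟩)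
    zify at hi
    linarith
  -- The sum telescopes: `D n` is the one term, from the coefficient of x^(2n+1), whose partner
  -- belongs to the summand n + 1. At n = m the guard fails and nothing is left.
  let D : ℕ → ℝ := fun i => if (i + 1) * (r + 2) ≤ m + 1 then
    a * (2 * i + 1) * cokerCoeff r a m i *
      coeff (expo (2 * i + 1) (m + 1 - (i + 1) * (r + 2))) f else 0
  have hsum : ∀ n : ℕ, ∑ i ∈ Finset.range (n + 1),
      (if i * (r + 2) ≤ m then cokerCoeff r a m i else 0) *
        coeff (expo (2 * i) (m - i * (r + 2))) (lieLead r a f) = D n := by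
    intro n
    induction n with
    | zero =>
      simp only [zero_add, Finset.sum_range_one, zero_mul, zero_le, if_true, Nat.sub_zero, mul_zero,
        coeff_lieLead, D, one_mul, cokerCoeff]
      by_cases h : r + 1 ≤ m
      · rw [if_pos h, if_pos (show r + 2 ≤ m + 1 by omega), if_neg (show ¬ 1 ≤ 0 by omega),
          show m - (r + 1) = m + 1 - (r + 2) by omega]
        push_cast; ring1
      · rw [if_neg h, if_neg (show ¬ 1 ≤ 0 by omega), if_neg (show ¬ r + 2 ≤ m + 1 by omega)]
        ring1
    | succ n ih =>
      rw [Finset.sum_range_succ, ih, coeff_lieLead]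
      have h2 : (n + 1 + 1) * (r + 2) = (n + 1) * (r + 2) + (r + 2) := by ring
      have h3 := hne n
      have hcast : (((n + 1) * (r + 2) : ℕ) : ℝ) = (n + 1) * (r + 2) := by push_cast; ring1
      have hcoef : cokerCoeff r a m (n + 1) =
        (2 * n + 1) * a * cokerCoeff r a m n / (m + 1 - (n + 1) * (r + 2)) := rfl
      simp only [D, h2]
      rw [← hcast] at hcoef
      generalize (n + 1) * (r + 2) = q at *
      have hD : (m : ℝ) + 1 - q ≠ 0 := by
        intro h0
        apply h3
        have : (q : ℝ) = ((m + 1 : ℕ) : ℝ) := by push_cast; linarith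
        exact_mod_cast this
      by_cases hq : q ≤ m
      · rw [if_pos hq, if_pos (show q ≤ m + 1 by omega), if_pos (show 1 ≤ 2 * (n + 1) by omega),
          show 2 * (n + 1) - 1 = 2 * n + 1 by omega, show m - q + 1 = m + 1 - q by omega]
        have e1 : cokerCoeff r a m (n + 1) * ((m - q : ℕ) + 1) =
            (2 * n + 1) * a * cokerCoeff r a m n := by
          rw [hcoef, Nat.cast_sub hq]
          field_simp
          ring1
        by_cases hq2 : r + 1 ≤ m - q
        · rw [if_pos hq2, if_pos (by omega),
            show m - q - (r + 1) = m + 1 - (q + (r + 2)) by omega]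
          push_cast at e1 ⊢
          linear_combination (-coeff (expo (2 * n + 1) (m + 1 - q)) f) * e1
        · rw [if_neg hq2, if_neg (by omega)]
          linear_combination (-coeff (expo (2 * n + 1) (m + 1 - q)) f) * e1
      · rw [if_neg hq, if_neg (show ¬ q ≤ m + 1 by omega),
          if_neg (show ¬ q + (r + 2) ≤ m + 1 by omega)]
        ring1
  rw [cokerFun_apply, hsum]
  refine if_neg ?_
  nlinarith

theorem cokerFun_eq_zero_of_mem_filt {r : ℕ} (a : ℝ) {m : ℕ} {f : Series}
    (hf : f ∈ filt r (2 * m + 1)) : cokerFun r a m f = 0 := by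
  rw [cokerFun_apply]
  refine Finset.sum_eq_zero fun i _ => ?_
  split_ifs with h
  · rw [hf _ ?_, mul_zero]
    rw [weight_expo]
    zify [h]
    nlinarith
  · rw [zero_mul]

theorem derivHam_vB (r : ℕ) (a : ℝ) (n : ℕ) :
    derivHam r a (vB 0 n) = mono 2 n + a • mono 0 (n + r + 2) := by
  have e : r + 1 + (n + 1) = n + r + 2 := by ring
  simp [derivHam_apply, vB, mono_mul_mono, e]

theorem cokerFun_derivHam_vB_ne_zero (r : ℕ) {a : ℝ} (ha : a ≠ 0) (n : ℕ) :
    cokerFun r a (n + r + 2) (derivHam r a (vB 0 n)) ≠ 0 := by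
  -- Only the indices 0 and 1 meet x^2 y^n + a y^(n+r+2), with `cokerCoeff` equal to 1 and a/(n+1).
  have h : cokerFun r a (n + r + 2) (derivHam r a (vB 0 n)) = a * (1 / (n + 1) + 1) := by
    rw [derivHam_vB, cokerFun_apply, show n + r + 2 + 1 = (n + r + 1) + 1 + 1 by ring,
      Finset.sum_range_succ', Finset.sum_range_succ', Finset.sum_eq_zero]
    · simp only [map_add, MvPowerSeries.coeff_smul, coeff_mono]
      have hd : ((n + r + 2 : ℕ) : ℝ) + 1 - ((0 : ℕ) + 1) * (r + 2) = n + 1 := by push_cast; ring1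
      have hc : cokerCoeff r a (n + r + 2) (0 + 1) = a / (n + 1) := by
        rw [← hd, cokerCoeff, cokerCoeff]
        push_cast
        ring1
      have h1 : n + r + 2 - (0 + 1) * (r + 2) = n := by omega
      rw [if_pos (by omega), h1, hc]
      simp [cokerCoeff]
      ring1
    · intro i _
      simp only [map_add, MvPowerSeries.coeff_smul, coeff_mono]
      rw [if_neg (c := 2 = _ ∧ _) (by omega), if_neg (c := 0 = _ ∧ _) (by omega)]
      simp
  rw [h]
  exact mul_ne_zero ha (by positivity)

/-! ### Solving the homological equation -/

/-- The vector fields of grade `k`. -/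
def homogV (r : ℕ) (k : ℤ) : Submodule ℝ VField where
  carrier := {v | ∀ i, v i ∈ homog r (varWeight r i + k)}
  add_mem' hv hw i := Submodule.add_mem _ (hv i) (hw i)
  zero_mem' _ := Submodule.zero_mem _
  smul_mem' c _ hv i := Submodule.smul_mem _ c (hv i)

/-- The vector fields all of whose terms have grade at least `k`. -/
def filtV (r : ℕ) (k : ℤ) : Submodule ℝ VField where
  carrier := {v | ∀ i, v i ∈ filt r (varWeight r i + k)}
  add_mem' hv hw i := Submodule.add_mem _ (hv i) (hw i)
  zero_mem' _ := Submodule.zero_mem _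
  smul_mem' c _ hv i := Submodule.smul_mem _ c (hv i)

theorem homogV_le_filtV (r : ℕ) (k : ℤ) : homogV r k ≤ filtV r k :=
  fun _ hv i => homog_le_filt _ _ (hv i)

theorem filtV_mono {r : ℕ} {k l : ℤ} (h : k ≤ l) {v : VField} (hv : v ∈ filtV r l) :
    v ∈ filtV r k := fun i => filt_mono (by omega) (hv i)

theorem lead_mem_homogV (r : ℕ) (a : ℝ) : lead r a ∈ homogV r r := by
  intro i
  fin_cases i
  · exact Submodule.smul_mem _ _ (mono_mem_homog (by simp [varWeight_zero]; ring))
  · exact Submodule.neg_mem _ (mono_mem_homog (by simp [varWeight_one]; ring))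

theorem derivHam_mem_homog {r : ℕ} (a : ℝ) {k : ℤ} {v : VField} (hv : v ∈ homogV r k) :
    derivHam r a v ∈ homog r (k + 2 * r + 4) := by
  rw [derivHam_apply]
  refine Submodule.add_mem _ ?_ ?_
  · have h := mul_mem_homog (mono_mem_homog' r 1 0) (hv 0)
    rw [varWeight_zero] at h
    exact homog_congr (by push_cast; ring) h
  · have h := mul_mem_homog (Submodule.smul_mem _ a (mono_mem_homog' r 0 (r + 1))) (hv 1)
    rw [varWeight_one] at h
    exact homog_congr (by push_cast; ring) h

theorem bracketRight_mem_homogV {r : ℕ} {k l : ℤ} {w v : VField} (hw : w ∈ homogV r l)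
    (hv : v ∈ homogV r k) : bracketRight w v ∈ homogV r (k + l) := by
  intro i
  rw [bracketRight_apply]
  refine Submodule.sum_mem _ fun j _ => Submodule.sub_mem _ ?_ ?_
  · have h := mul_mem_homog (hv j) (pderiv_mem_homog (hw i) j)
    exact homog_congr (by ring) h
  · have h := mul_mem_homog (hw j) (pderiv_mem_homog (hv i) j)
    exact homog_congr (by ring) h

theorem smul_mem_homogV {r : ℕ} {k l : ℤ} {f : Series} {w : VField} (hw : w ∈ homogV r l)
    (hf : f ∈ homog r k) : f • w ∈ homogV r (k + l) := by
  intro i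
  have h := mul_mem_homog hf (hw i)
  rw [Pi.smul_apply, smul_eq_mul]
  exact homog_congr (by ring) h

/-- Such an `F` lies in the ideal (x, y^(r+1)): a pure power y^q with q ≤ r has weight at most 2r,
which is too small. The part divisible by x determines `S 0`, the pure powers of y determine `S 1`.
-/
theorem exists_derivHam_eq {r : ℕ} {a : ℝ} (ha : a ≠ 0) {j : ℤ} (hj : 1 ≤ j) {F : Series}
    (hF : F ∈ homog r (j + 2 * r + 4)) : ∃ S ∈ homogV r j, derivHam r a S = F := by
  refine ⟨![ofCoeff fun n => coeff (expo (n 0 + 1) (n 1)) F,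
    a⁻¹ • ofCoeff fun n => if n 0 = 0 then coeff (expo 0 (n 1 + (r + 1))) F else 0], ?_, ?_⟩
  · intro i
    fin_cases i
    · intro n hn
      refine hF _ fun h => hn ?_
      rw [weight_expo] at h
      simp only [weight, varWeight_zero, Fin.zero_eta]
      push_cast at h
      linarith
    · refine Submodule.smul_mem _ _ fun n hn => ?_
      rw [coeff_ofCoeff]
      split_ifs with h0
      · refine hF _ fun h => hn ?_
        rw [weight_expo] at h
        simp only [weight, varWeight_one, Fin.mk_one, h0]
        push_cast at h ⊢
        linarith
      · rfl
  · refine series_ext fun p q => ?_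
    rw [derivHam_apply]
    simp only [Matrix.cons_val_zero, Matrix.cons_val_one, map_add, smul_mul_smul_comm, mul_inv_cancel₀ ha,
      one_smul, coeff_mono_mul, coeff_ofCoeff, expo_zero, expo_one, zero_le, true_and, and_true,
      Nat.sub_zero]
    by_cases hp : 1 ≤ p
    · rw [if_pos hp, Nat.sub_add_cancel hp, if_neg (show p ≠ 0 by omega)]
      simp
    · obtain rfl : p = 0 := by omega
      by_cases hq : r + 1 ≤ q
      · rw [if_neg hp, if_pos hq, if_pos rfl, Nat.sub_add_cancel hq, zero_add]
      · rw [if_neg hp, if_neg hq, hF, add_zero]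
        rw [weight_expo]
        push_cast
        omega

/-- From x U_0 + a y^(r+1) U_1 = 0 it follows that x divides U_1, since x and y^(r+1) have no common
factor; the quotient, with a sign, is the multiplier. -/
theorem exists_smul_lead_eq {r : ℕ} {a : ℝ} (ha : a ≠ 0) {j : ℤ} {U : VField}
    (hU : U ∈ homogV r (j + r)) (h0 : derivHam r a U = 0) :
    ∃ τ ∈ homog r j, U = τ • lead r a := by
  let τ : Series := -ofCoeff fun n => coeff (expo (n 0 + 1) (n 1)) (U 1)
  have hU1 : U 1 = -(mono 1 0 * τ) := by
    refine series_ext fun p q => ?_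
    simp only [τ, mul_neg, neg_neg, coeff_mono_mul, coeff_ofCoeff, expo_zero, expo_one, zero_le,
      and_true, Nat.sub_zero]
    split_ifs with hp
    · rw [Nat.sub_add_cancel hp]
    · obtain rfl : p = 0 := by omega
      have h := congrArg (coeff (expo 0 (q + (r + 1)))) h0
      rw [derivHam_apply, map_add, smul_mul_assoc, MvPowerSeries.coeff_smul, coeff_mono_mul,
        coeff_mono_mul] at h
      simpa [ha] using h
  have hU0 : U 0 = (a • mono 0 (r + 1)) * τ := by
    have hx : mono 1 0 ≠ 0 := fun h => by
      have := congrArg (coeff (expo 1 0)) h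
      simp [coeff_mono] at this
    refine mul_left_cancel₀ hx ?_
    rw [derivHam_apply, hU1] at h0
    linear_combination h0
  refine ⟨τ, Submodule.neg_mem _ fun n hn => ?_, ?_⟩
  · refine hU 1 _ fun h => hn ?_
    rw [weight_expo, varWeight_one] at h
    rw [weight]
    push_cast at h
    linarith
  · funext i
    fin_cases i
    · simp [lead, hU0, mul_comm]
    · simp [lead, hU1, mul_comm]

/-- Choose `S` with S(h) = F. Then e - [S, L] annihilates h and is therefore a multiple of L, which
the time rescaling absorbs. -/
theorem exists_homological {r : ℕ} {a : ℝ} (ha : a ≠ 0) {k : ℤ} (hk : (r : ℤ) + 1 ≤ k)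
    {e : VField} (he : e ∈ homogV r k) {F : Series} (hF : F ∈ homog r (k + r + 4))
    (h : derivHam r a e = -lieLead r a F) :
    ∃ τ ∈ homog r (k - r), ∃ S ∈ homogV r (k - r),
      e = τ • lead r a + bracketRight (lead r a) S := by
  obtain ⟨S, hS, hSF⟩ := exists_derivHam_eq ha (j := k - r) (by omega) (F := F)
    (homog_congr (by ring) hF)
  have hb : bracketRight (lead r a) S ∈ homogV r (k - r + r) :=
    bracketRight_mem_homogV (lead_mem_homogV r a) hS
  obtain ⟨τ, hτ, e1⟩ := exists_smul_lead_eq ha (U := e - bracketRight (lead r a) S)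
    (Submodule.sub_mem _ (by rwa [sub_add_cancel]) hb)
    (by rw [map_sub, h, derivHam_bracket_lead, hSF]; simp)
  exact ⟨τ, hτ, S, hS, by rw [← e1]; abel⟩

/-- The candidates for the homogeneous parts of the normal form. -/
def resid (r : ℕ) (k : ℤ) : Submodule ℝ VField :=
  Submodule.span ℝ {e | ∃ n : ℕ, 2 * (n : ℤ) = k ∧
    ¬ (n : ℤ) ≡ -1 [ZMOD ((r : ℤ) + 2)] ∧ e = vB 0 n}

theorem vB_mem_homogV {r : ℕ} {k : ℤ} {n : ℕ} (h : 2 * (n : ℤ) = k) : vB 0 n ∈ homogV r k := by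
  intro i
  fin_cases i
  · exact mono_mem_homog (by simp [varWeight_zero, ← h])
  · exact mono_mem_homog (by simp [varWeight_one, ← h]; ring)

theorem resid_le_homogV (r : ℕ) (k : ℤ) : resid r k ≤ homogV r k := by
  refine Submodule.span_le.2 ?_
  rintro _ ⟨n, hn, -, rfl⟩
  exact vB_mem_homogV hn

theorem exists_homological_resid {r : ℕ} {a : ℝ} (ha : a ≠ 0) {k : ℤ} (hk : (r : ℤ) + 1 ≤ k)
    {e : VField} (he : e ∈ homogV r k) :
    ∃ τ ∈ homog r (k - r), ∃ S ∈ homogV r (k - r), ∃ c ∈ resid r k,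
      e = τ • lead r a + bracketRight (lead r a) S + c := by
  suffices ∃ c ∈ resid r k, ∃ F ∈ homog r (k + r + 4), derivHam r a (e - c) = -lieLead r a F by
    obtain ⟨c, hc, F, hF, h⟩ := this
    obtain ⟨τ, hτ, S, hS, e1⟩ := exists_homological ha hk
      (Submodule.sub_mem _ he (resid_le_homogV r k hc)) hF h
    exact ⟨τ, hτ, S, hS, c, hc, by rw [← e1]; abel⟩
  obtain ⟨g, ⟨F, hF, rfl⟩, p, hp, hgp⟩ := Submodule.mem_sup.1
    (homog_le_map_lieLead_sup r ha _ (derivHam_mem_homog a he))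
  have hF' : F ∈ homog r (k + r + 4) :=
    homog_congr (by ring) hF
  by_cases hm : ∃ m : ℕ, 2 * (m : ℤ) = k + 2 * r + 4 ∧ ¬ (m : ℤ) ≡ -1 [ZMOD ((r : ℤ) + 2)]
  · obtain ⟨m, hm, hm1⟩ := hm
    obtain ⟨n, rfl⟩ : ∃ n : ℕ, m = n + r + 2 := ⟨m - (r + 2), by omega⟩
    obtain ⟨β, rfl⟩ : ∃ β : ℝ, β • mono 0 (n + r + 2) = p := by
      refine Submodule.mem_span_singleton.1 (Submodule.span_mono ?_ hp)
      rintro _ ⟨m', h1, -, rfl⟩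
      rw [show m' = n + r + 2 by omega]
      rfl
    have hn1 : ¬ (n : ℤ) ≡ -1 [ZMOD ((r : ℤ) + 2)] := by
      intro h
      refine hm1 ?_
      push_cast
      rw [add_assoc]
      exact (Int.add_modEq_right).trans h
    have hn0 : (n : ℝ) + 1 ≠ 0 := by positivity
    -- The class of B^0_n(h) in the cokernel is γ y^(n+r+2), after x^2 y^n is removed with L(x
    -- y^(n+1)). The correction β/γ then matches the residue β y^(n+r+2).
    set γ : ℝ := a * (1 / (n + 1) + 1) with hγ
    have hγ0 : γ ≠ 0 := mul_ne_zero ha (by positivity)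
    have hvB : derivHam r a (vB 0 n) = γ • mono 0 (n + r + 2) -
        (1 / ((n : ℝ) + 1)) • lieLead r a (mono 1 (n + 1)) := by
      rw [derivHam_vB, lieLead_mono, show n + 1 + (r + 1) = n + r + 2 by ring, hγ, smul_sub,
        smul_smul, smul_smul, mul_add, add_smul]
      simp [hn0]
      rw [mul_comm]
      abel
    refine ⟨(β / γ) • vB 0 n, Submodule.smul_mem _ _ (Submodule.subset_span ⟨n, by omega, hn1, rfl⟩),
      -(F + (β / γ * (1 / ((n : ℝ) + 1))) • mono 1 (n + 1)), Submodule.neg_mem _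
      (Submodule.add_mem _ hF' (Submodule.smul_mem _ _ (mono_mem_homog ?_))), ?_⟩
    · push_cast at hm ⊢; linarith
    · rw [map_sub, map_smul, hvB, ← hgp, smul_sub, smul_smul, smul_smul, div_mul_cancel₀ _ hγ0,
        map_neg, neg_neg, map_add, map_smul]
      abel
  · have hp0 : p = 0 := by
      refine (Submodule.mem_bot ℝ).1 ?_
      have : {e | ∃ m : ℕ, 2 * (m : ℤ) = k + 2 * r + 4 ∧
          ¬ (m : ℤ) ≡ -1 [ZMOD ((r : ℤ) + 2)] ∧ e = mono 0 m} = ∅ := by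
        refine Set.eq_empty_iff_forall_notMem.2 ?_
        rintro _ ⟨m, h1, h2, -⟩
        exact hm ⟨m, h1, h2⟩
      rwa [this, Submodule.span_empty] at hp
    refine ⟨0, Submodule.zero_mem _, -F, Submodule.neg_mem _ hF', ?_⟩
    rw [sub_zero, ← hgp, hp0, map_neg, neg_neg, add_zero]

/-! ### Components -/

theorem coeff_component (r : ℕ) (k : ℤ) (v : VField) (i : Fin 2) (n : Fin 2 →₀ ℕ) :
    coeff n (component r k v i) = if weight r n - varWeight r i = k then coeff n (v i) else 0 :=
  rfl

theorem component_mem_homogV (r : ℕ) (k : ℤ) (v : VField) : component r k v ∈ homogV r k := by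
  intro i n hn
  rw [coeff_component, if_neg (by omega)]

theorem component_sub (r : ℕ) (k : ℤ) (v w : VField) :
    component r k (v - w) = component r k v - component r k w := by
  funext i
  ext n
  simp only [coeff_component, Pi.sub_apply, map_sub]
  split_ifs <;> simp

theorem component_of_mem_homogV {r : ℕ} {k : ℤ} {v : VField} (hv : v ∈ homogV r k) :
    component r k v = v := by
  funext i
  ext n
  rw [coeff_component]
  split_ifs with h
  · rfl
  · exact (hv i n (by omega)).symm

theorem component_of_mem_filtV {r : ℕ} {k l : ℤ} (h : k < l) {v : VField} (hv : v ∈ filtV r l) :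
    component r k v = 0 := by
  funext i
  ext n
  rw [coeff_component]
  split_ifs with h'
  · exact hv i n (by omega)
  · rfl

theorem component_of_mem_homogV_ne {r : ℕ} {k l : ℤ} (h : k ≠ l) {v : VField}
    (hv : v ∈ homogV r l) : component r k v = 0 := by
  funext i
  ext n
  rw [coeff_component]
  split_ifs with h'
  · exact hv i n (by omega)
  · rfl

theorem sub_component_mem_filtV {r : ℕ} {k : ℤ} {v : VField} (hv : v ∈ filtV r k) :
    v - component r k v ∈ filtV r (k + 1) := by
  intro i n hn
  rw [Pi.sub_apply, map_sub, coeff_component]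
  split_ifs with h
  · exact sub_self _
  · rw [sub_zero]
    exact hv i n (by omega)

theorem component_congr {r : ℕ} {k l : ℤ} (h : k < l) {v w : VField} (hv : v - w ∈ filtV r l) :
    component r k v = component r k w := by
  rw [← sub_eq_zero, ← component_sub, component_of_mem_filtV h hv]

/-! ### The terms -/

/-- With p = l + 1 the A-term is the Hamiltonian field of x^p y^(n+2-p)/(n+2). This form also
disposes of the truncated exponents at the two ends of the range, where the coefficient is zero. -/
theorem vA_eq {n p : ℕ} (hp : p ≤ n + 2) :
    vA ((p : ℤ) - 1) n =
      ![(1 / ((n : ℝ) + 2)) • pderiv ℝ 1 (mono p (n + 2 - p)),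
        -((1 / ((n : ℝ) + 2)) • pderiv ℝ 0 (mono p (n + 2 - p)))] := by
  rw [pderiv_zero_mono, pderiv_one_mono, smul_smul, smul_smul, vA]
  have e1 : ((p : ℤ) - 1 + 1).toNat = p := by omega
  have e2 : ((n : ℤ) - (p - 1)).toNat = n + 2 - p - 1 := by omega
  have e3 : ((p : ℤ) - 1).toNat = p - 1 := by omega
  have e4 : ((n : ℤ) - (p - 1) + 1).toNat = n + 2 - p := by omega
  have e5 : ((n : ℤ) - (p - 1) + 1) = ((n + 2 - p : ℕ) : ℤ) := by omega
  rw [e1, e2, e3, e4, e5, sub_add_cancel, Int.cast_natCast, Int.cast_natCast, one_div_mul_eq_div,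
    one_div_mul_eq_div]

theorem vB_eq {n l : ℕ} (hl : l ≤ n) :
    vB l n = ![mono (l + 1) (n - l), mono l (n - l + 1)] := by
  have e1 : ((l : ℤ) + 1).toNat = l + 1 := by omega
  have e2 : ((n : ℤ) - l).toNat = n - l := by omega
  have e3 : ((n : ℤ) - l + 1).toNat = n - l + 1 := by omega
  rw [vB, e1, e2, e3, Int.toNat_natCast]

theorem lead_eq (r : ℕ) (a : ℝ) : vA 1 0 + a • vA (-1) r = lead r a := by
  have h1 := vA_eq (n := 0) (p := 2) le_rfl
  have h2 := vA_eq (n := r) (p := 0) (by omega)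
  norm_num at h1 h2
  have h3 : (r : ℝ) + 2 ≠ 0 := by positivity
  rw [h1, h2, pderiv_zero_mono, pderiv_zero_mono, pderiv_one_mono, pderiv_one_mono]
  funext i
  fin_cases i
  · simp [lead, smul_smul, h3]
  · simp [lead, smul_smul]

theorem derivHam_vA (r : ℕ) (a : ℝ) {n p : ℕ} (hp : p ≤ n + 2) :
    derivHam r a (vA ((p : ℤ) - 1) n) =
      -lieLead r a ((1 / ((n : ℝ) + 2)) • mono p (n + 2 - p)) := by
  rw [vA_eq hp, derivHam_apply, map_smul, lieLead_apply]
  simp only [Matrix.cons_val_zero, Matrix.cons_val_one, MvPowerSeries.smul_eq_C_mul]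
  ring1

theorem vA_mem_homogV (r : ℕ) {n p : ℕ} (hp : p ≤ n + 2) :
    vA ((p : ℤ) - 1) n ∈ homogV r (((p : ℤ) - 1) * r + 2 * n) := by
  have hM := mono_mem_homog' r p (n + 2 - p)
  rw [vA_eq hp]
  intro i
  fin_cases i
  · refine Submodule.smul_mem _ _ (homog_congr ?_ (pderiv_mem_homog hM 1))
    simp only [Fin.zero_eta, varWeight_zero, varWeight_one]
    push_cast [hp]
    ring1
  · refine Submodule.neg_mem _ (Submodule.smul_mem _ _ (homog_congr ?_ (pderiv_mem_homog hM 0)))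
    simp only [Fin.mk_one, varWeight_zero, varWeight_one]
    push_cast [hp]
    ring1

theorem vB_mem_homogV' (r : ℕ) {n l : ℕ} (hl : l ≤ n) :
    vB l n ∈ homogV r ((l : ℤ) * r + 2 * n) := by
  rw [vB_eq hl]
  intro i
  fin_cases i
  · refine mono_mem_homog ?_
    simp only [Fin.zero_eta, varWeight_zero]
    push_cast [hl]
    ring1
  · refine mono_mem_homog ?_
    simp only [Fin.mk_one, varWeight_one]
    push_cast [hl]
    ring1

theorem Term.Admissible.exists_A {l : ℤ} {n : ℕ} (h : (Term.A l n).Admissible) :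
    ∃ p : ℕ, p ≤ n + 2 ∧ l = (p : ℤ) - 1 :=
  ⟨(l + 1).toNat, by have := h.1; have := h.2.1; omega, by have := h.1; omega⟩

theorem Term.Admissible.exists_B {l : ℤ} {n : ℕ} (h : (Term.B l n).Admissible) :
    ∃ p : ℕ, p ≤ n ∧ l = p :=
  ⟨l.toNat, by have := h.1; have := h.2.1; omega, by have := h.1; omega⟩

theorem Term.Admissible.field_mem_homogV {t : Term} (ht : t.Admissible) (r : ℕ) :
    t.field ∈ homogV r (t.grade r) := by
  cases t with
  | A l n =>
    obtain ⟨p, hp, rfl⟩ := ht.exists_A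
    exact vA_mem_homogV r hp
  | B l n =>
    obtain ⟨p, hp, rfl⟩ := ht.exists_B
    exact vB_mem_homogV' r hp

theorem gradedL_le_homogV (r : ℕ) (k : ℤ) : gradedL r k ≤ homogV r k := by
  refine Submodule.span_le.2 ?_
  rintro _ ⟨t, ht, rfl, rfl⟩
  exact ht.field_mem_homogV r

theorem field_mem_gradedL {r : ℕ} {k : ℤ} {t : Term} (ht : t.Admissible) (h : t.grade r = k) :
    t.field ∈ gradedL r k := Submodule.subset_span ⟨t, ht, h, rfl⟩

theorem single_zero_mono_mem_gradedL {r p q : ℕ} {k : ℤ} (hk : 1 ≤ k)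
    (h : ((r : ℤ) + 2) * p + 2 * q = varWeight r 0 + k) :
    (Pi.single 0 (mono p q) : VField) ∈ gradedL r k := by
  rw [varWeight_zero] at h
  have hpq : 2 ≤ p + q := by
    by_contra hlt
    have : (p = 0 ∧ q ≤ 1) ∨ (p = 1 ∧ q = 0) := by omega
    rcases this with ⟨rfl, hq⟩ | ⟨rfl, rfl⟩ <;> push_cast at h <;> omega
  obtain ⟨n, hn⟩ : ∃ n, p + q = n + 1 := ⟨p + q - 1, by omega⟩
  have hq : n + 2 - p - 1 = q := by omega
  have hn2 : (n : ℝ) + 2 ≠ 0 := by positivity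
  have hc : ((p : ℝ) + q) = n + 1 := by exact_mod_cast hn
  have hcZ : ((p : ℤ) + q) = n + 1 := by exact_mod_cast hn
  have hA : vA ((p : ℤ) - 1) n ∈ gradedL r k :=
    field_mem_gradedL (t := .A ((p : ℤ) - 1) n) ⟨by omega, by omega, by omega⟩
      (by simp only [Term.grade]; linarith)
  rw [vA_eq (by omega)] at hA
  rcases Nat.eq_zero_or_pos p with rfl | hp
  · convert hA using 1
    funext i
    fin_cases i
    · simp [pderiv_one_mono, smul_smul, hn2, show n + 1 = q by omega]
    · simp [pderiv_zero_mono]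
  · obtain ⟨l, rfl⟩ : ∃ l, p = l + 1 := ⟨p - 1, by omega⟩
    have hB : vB l n ∈ gradedL r k :=
      field_mem_gradedL (t := .B l n) ⟨by omega, by omega, by omega⟩
        (by simp only [Term.grade]; push_cast at h hcZ; linarith)
    rw [vB_eq (by omega)] at hB
    convert Submodule.add_mem _ hA (Submodule.smul_mem _ (((l : ℝ) + 1) / (n + 2)) hB) using 1
    have e1 : n - l = q := by omega
    have e2 : n + 2 - (l + 1) = q + 1 := by omega
    push_cast at hc
    funext i
    fin_cases i
    · simp [pderiv_one_mono, smul_smul, e1, e2, ← add_smul]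
      rw [show ((n : ℝ) + 2)⁻¹ * (q + 1) + (l + 1) / (n + 2) = 1 by
        field_simp; linarith, one_smul]
    · simp [pderiv_zero_mono, smul_smul, e1, e2]
      rw [inv_mul_eq_div, neg_add_cancel]

theorem single_one_mono_mem_gradedL {r p q : ℕ} {k : ℤ} (hk : 1 ≤ k)
    (h : ((r : ℤ) + 2) * p + 2 * q = varWeight r 1 + k) :
    (Pi.single 1 (mono p q) : VField) ∈ gradedL r k := by
  rw [varWeight_one] at h
  have hpq : 2 ≤ p + q ∨ (p = 1 ∧ q = 0) := by
    by_contra hlt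
    have : p = 0 ∧ q ≤ 1 := by omega
    rcases this with ⟨rfl, hq⟩
    push_cast at h
    omega
  obtain ⟨n, hn⟩ : ∃ n, p + q = n + 1 := ⟨p + q - 1, by omega⟩
  have hn2 : (n : ℝ) + 2 ≠ 0 := by positivity
  have hc : ((p : ℝ) + q) = n + 1 := by exact_mod_cast hn
  have hcZ : ((p : ℤ) + q) = n + 1 := by exact_mod_cast hn
  have hA : vA (((p + 1 : ℕ) : ℤ) - 1) n ∈ gradedL r k :=
    field_mem_gradedL (t := .A (((p + 1 : ℕ) : ℤ) - 1) n) ⟨by omega, by omega, by omega⟩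
      (by simp only [Term.grade]; push_cast; linarith)
  rw [vA_eq (by omega)] at hA
  rcases Nat.eq_zero_or_pos q with rfl | hq
  · convert Submodule.neg_mem _ hA using 1
    funext i
    fin_cases i
    · simp [pderiv_one_mono, show n + 2 - (p + 1) = 0 by omega]
    · simp [pderiv_zero_mono, smul_smul, show n + 2 - (p + 1) = 0 by omega]
      rw [show ((n : ℝ) + 2)⁻¹ * (p + 1) = 1 by
        field_simp; push_cast at hc; linarith, one_smul]
  · obtain ⟨m, rfl⟩ : ∃ m, q = m + 1 := ⟨q - 1, by omega⟩
    have hB : vB p n ∈ gradedL r k :=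
      field_mem_gradedL (t := .B p n) ⟨by omega, by omega, by omega⟩
        (by simp only [Term.grade]; push_cast at h hcZ; linarith)
    rw [vB_eq (by omega)] at hB
    convert Submodule.sub_mem _
      (Submodule.smul_mem _ (((m : ℝ) + 1) / (n + 2)) hB) hA using 1
    have e1 : n - p = m := by omega
    have e2 : n + 2 - (p + 1) = m + 1 := by omega
    push_cast at hc
    funext i
    fin_cases i
    · simp [pderiv_one_mono, smul_smul, e1, e2]
      rw [inv_mul_eq_div, sub_self]
    · simp [pderiv_zero_mono, smul_smul, e1, e2, ← add_smul]
      rw [show (m + 1) / ((n : ℝ) + 2) + (n + 2 : ℝ)⁻¹ * (p + 1) = 1 by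
        field_simp; linarith, one_smul]

/-- In positive grade the restriction on the admissible terms costs nothing: the only constant or
linear monomial field of positive grade is x ∂y, which is -A^1_0. -/
theorem gradedL_eq_homogV (r : ℕ) {k : ℤ} (hk : 1 ≤ k) : gradedL r k = homogV r k := by
  refine le_antisymm (gradedL_le_homogV r k) fun v hv => ?_
  have key : ∀ (i : Fin 2) (f : Series), f ∈ homog r (varWeight r i + k) →
      (Pi.single i f : VField) ∈ gradedL r k := by
    intro i f hf
    have : homog r (varWeight r i + k) ≤ (gradedL r k).comap (LinearMap.single ℝ _ i) := by
      refine (homog_le_span r _).trans (Submodule.span_le.2 ?_)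
      rintro _ ⟨p, q, h, rfl⟩
      fin_cases i
      · exact single_zero_mono_mem_gradedL hk h
      · exact single_one_mono_mem_gradedL hk h
    exact this hf
  rw [← Finset.univ_sum_single v]
  exact Submodule.sum_mem _ fun i _ => key i _ (hv i)

theorem gradedR_eq_homog (r : ℕ) {k : ℤ} (hk : 1 ≤ k) : gradedR r k = homog r k := by
  refine le_antisymm (Submodule.span_le.2 ?_) ((homog_le_span r k).trans (Submodule.span_mono ?_))
  · rintro _ ⟨l, n, -, hl, h, rfl⟩
    refine mono_mem_homog ?_
    rw [← h]
    push_cast [hl]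
    ring1
  · rintro _ ⟨p, q, h, rfl⟩
    refine ⟨p, p + q, ?_, by omega, ?_, by rw [Nat.add_sub_cancel_left]⟩
    · by_contra hlt
      obtain ⟨rfl, rfl⟩ : p = 0 ∧ q = 0 := by omega
      push_cast at h
      omega
    · rw [← h]
      push_cast
      ring1

theorem mem_gens {r : ℕ} {k : ℤ} (hk : 1 ≤ k) {p : Series × VField} :
    p ∈ gens r k ↔ p.1 ∈ homog r k ∧ p.2 ∈ homogV r k := by
  rw [gens, if_pos hk, Submodule.mem_prod, gradedL_eq_homogV r hk, gradedR_eq_homog r hk]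

theorem gens_eq_bot {r : ℕ} {k : ℤ} (hk : k ≤ 0) : gens r k = ⊥ := by
  rw [gens, if_neg (by omega)]

/-! ### The image of `d^{k,r+1}` -/

theorem dMap_eq_zero {r : ℕ} {w : VField} (h0 : ∀ i : ℕ, i < r → component r i w = 0) {ρ : ℕ}
    (hρ : ρ ≤ r) : dMap r w ρ = 0 := by
  refine Finset.sum_eq_zero fun i hi => ?_
  rw [Finset.mem_range] at hi
  rw [h0 i (by omega)]
  ext p j
  simp [actOn, bracketRight_apply]

/-- The kernels in the recursive domain are those of d^{·,ρ} with ρ ≤ r, and these maps involve only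
components of grade below r, which vanish. -/
theorem mem_dDom_iff {r : ℕ} {w : VField} (h0 : ∀ i : ℕ, i < r → component r i w = 0) {ρ : ℕ}
    (hρ : ρ ≤ r + 1) (k : ℤ) (p : ℕ → Series × VField) :
    p ∈ dDom r w ρ k ↔ ∀ i < ρ, p i ∈ gens r (k - i) := by
  induction ρ generalizing k p with
  | zero => simp [dDom]
  | succ ρ ih =>
    rw [dDom, dMap_eq_zero h0 (by omega), LinearMap.ker_zero, inf_top_eq, Submodule.mem_inf,
      Submodule.mem_comap, Submodule.mem_comap, ih (by omega)]
    constructor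
    · rintro ⟨h1, h2⟩ i hi
      cases i with
      | zero => simpa using h1
      | succ i =>
        have := h2 i (by omega)
        rwa [sub_sub, add_comm (1 : ℤ), ← Nat.cast_succ] at this
    · intro h
      refine ⟨by simpa using h 0 (by omega), fun i hi => ?_⟩
      have := h (i + 1) (by omega)
      rwa [Nat.cast_succ, add_comm (i : ℤ), ← sub_sub] at this

theorem dImage_eq {r : ℕ} {w u : VField} (h0 : ∀ i : ℕ, i < r → component r i w = 0)
    (hr : component r r w = u) (k : ℤ) :
    dImage r w (r + 1) k = (gens r (k - r)).map (actOn u) := by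
  have hd : ∀ p, dMap r w (r + 1) p = actOn u (p r) := by
    intro p
    have : dMap r w (r + 1) = dMap r w r + (actOn (component r r w)).comp (LinearMap.proj r) :=
      Finset.sum_range_succ _ _
    rw [this, dMap_eq_zero h0 le_rfl, zero_add, hr]
    rfl
  ext e
  simp only [dImage, Submodule.mem_map, mem_dDom_iff h0 le_rfl, hd]
  constructor
  · rintro ⟨p, hp, rfl⟩
    exact ⟨p r, hp r (by omega), rfl⟩
  · rintro ⟨q, hq, rfl⟩
    refine ⟨Pi.single r q, fun i hi => ?_, by simp⟩
    by_cases h : i = r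
    · subst h; simpa using hq
    · rw [Pi.single_eq_of_ne h]; exact Submodule.zero_mem _

/-- The image of the homological operator of `lead r a` in grade `k`. -/
def leadImage (r : ℕ) (a : ℝ) (k : ℤ) : Submodule ℝ VField :=
  (gens r (k - r)).map (actOn (lead r a))

theorem leadImage_eq_bot {r : ℕ} (a : ℝ) {k : ℤ} (hk : k ≤ r) : leadImage r a k = ⊥ := by
  rw [leadImage, gens_eq_bot (by omega), Submodule.map_bot]

theorem mem_leadImage {r : ℕ} {a : ℝ} {k : ℤ} (hk : (r : ℤ) + 1 ≤ k) {e : VField} :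
    e ∈ leadImage r a k ↔ ∃ τ ∈ homog r (k - r), ∃ S ∈ homogV r (k - r),
      e = τ • lead r a + bracketRight (lead r a) S := by
  rw [leadImage, Submodule.mem_map]
  constructor
  · rintro ⟨p, hp, rfl⟩
    rw [mem_gens (by omega)] at hp
    exact ⟨p.1, hp.1, p.2, hp.2, rfl⟩
  · rintro ⟨τ, hτ, S, hS, rfl⟩
    exact ⟨(τ, S), (mem_gens (by omega)).2 ⟨hτ, hS⟩, rfl⟩

theorem leadImage_le_homogV {r : ℕ} (a : ℝ) {k : ℤ} (hk : (r : ℤ) + 1 ≤ k) :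
    leadImage r a k ≤ homogV r k := by
  intro e he
  obtain ⟨τ, hτ, S, hS, rfl⟩ := (mem_leadImage hk).1 he
  have h := Submodule.add_mem _ (smul_mem_homogV (lead_mem_homogV r a) hτ)
    (bracketRight_mem_homogV (lead_mem_homogV r a) hS)
  rwa [sub_add_cancel] at h

theorem homogV_le_leadImage_sup {r : ℕ} {a : ℝ} (ha : a ≠ 0) {k : ℤ} (hk : (r : ℤ) + 1 ≤ k) :
    homogV r k ≤ leadImage r a k ⊔ resid r k := by
  intro e he
  obtain ⟨τ, hτ, S, hS, c, hc, rfl⟩ := exists_homological_resid ha hk he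
  exact Submodule.add_mem_sup ((mem_leadImage hk).2 ⟨τ, hτ, S, hS, rfl⟩) hc

theorem vA_mem_leadImage {r : ℕ} {a : ℝ} (ha : a ≠ 0) {k : ℤ} (hk : (r : ℤ) + 1 ≤ k) {l : ℤ}
    {n : ℕ} (ht : (Term.A l n).Admissible) (hg : (Term.A l n).grade r = k) :
    vA l n ∈ leadImage r a k := by
  have hm := ht.field_mem_homogV r
  rw [hg] at hm
  obtain ⟨p, hp, rfl⟩ := ht.exists_A
  refine (mem_leadImage hk).2 (exists_homological ha hk hm (Submodule.smul_mem _ _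
    (mono_mem_homog ?_)) (derivHam_vA r a hp))
  rw [← hg, Term.grade]
  push_cast [hp]
  ring1

theorem cokerFun_leadImage {r : ℕ} (a : ℝ) {k : ℤ} (hk : (r : ℤ) + 1 ≤ k) {m : ℕ}
    (hm : ¬ (m : ℤ) ≡ -1 [ZMOD ((r : ℤ) + 2)]) :
    leadImage r a k ≤ LinearMap.ker (cokerFun r a m ∘ₗ derivHam r a) := by
  intro e he
  obtain ⟨τ, hτ, S, hS, rfl⟩ := (mem_leadImage hk).1 he
  rw [LinearMap.mem_ker, LinearMap.comp_apply, map_add, derivHam_smul_lead, derivHam_bracket_lead,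
    zero_add, map_neg, cokerFun_lieLead r a hm, neg_zero]

theorem not_modEq_add {r n : ℕ} (h : ¬ (n : ℤ) ≡ -1 [ZMOD ((r : ℤ) + 2)]) :
    ¬ ((n + r + 2 : ℕ) : ℤ) ≡ -1 [ZMOD ((r : ℤ) + 2)] := fun h' => h (by
  push_cast at h'
  rw [add_assoc] at h'
  exact (Int.add_modEq_right).symm.trans h')

theorem disjoint_leadImage_resid {r : ℕ} {a : ℝ} (ha : a ≠ 0) {k : ℤ} (hk : (r : ℤ) + 1 ≤ k) :
    Disjoint (leadImage r a k) (resid r k) := by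
  rw [Submodule.disjoint_def]
  intro e he hr
  by_cases hn : ∃ n : ℕ, 2 * (n : ℤ) = k ∧ ¬ (n : ℤ) ≡ -1 [ZMOD ((r : ℤ) + 2)]
  · obtain ⟨n, hn, hn1⟩ := hn
    obtain ⟨c, rfl⟩ : ∃ c : ℝ, c • vB 0 n = e := by
      refine Submodule.mem_span_singleton.1 (Submodule.span_mono ?_ hr)
      rintro _ ⟨m, h1, -, rfl⟩
      rw [show m = n by omega]
      rfl
    have h := cokerFun_leadImage a hk (not_modEq_add hn1) he
    rw [LinearMap.mem_ker, LinearMap.comp_apply, map_smul, map_smul, smul_eq_mul] at h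
    rw [(mul_eq_zero.1 h).resolve_right (cokerFun_derivHam_vB_ne_zero r ha n), zero_smul]
  · have : {e | ∃ n : ℕ, 2 * (n : ℤ) = k ∧
        ¬ (n : ℤ) ≡ -1 [ZMOD ((r : ℤ) + 2)] ∧ e = vB 0 n} = ∅ := by
      refine Set.eq_empty_iff_forall_notMem.2 ?_
      rintro _ ⟨n, h1, h2, -⟩
      exact hn ⟨n, h1, h2⟩
    rwa [resid, this, Submodule.span_empty, Submodule.mem_bot] at hr

/-! ### The style space -/

/-- The span of the terms of grade `k` that are eliminated later than `t`. -/
def laterSpan (r : ℕ) (k : ℤ) (t : Term) : Submodule ℝ VField :=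
  Submodule.span ℝ {f | ∃ u : Term, u.Admissible ∧ u.grade r = k ∧ t.Before u ∧ f = u.field}

/-- A-terms lie in the image. A term B^l_n with l ≥ 1 reduces modulo the image to some B^0_m of
equal grade, so m > n and it is eliminated in favour of a later term, or reduces to zero. B^0_n is
the last B-term of its grade, so only the image can remove it, which happens exactly for n ≡ -1. -/
theorem styleSpace_eq_resid {r : ℕ} (hr : 1 ≤ r) {a : ℝ} (ha : a ≠ 0) {k : ℤ}
    (hk : (r : ℤ) + 1 ≤ k) {w : VField} (hw : dImage r w (r + 1) k = leadImage r a k) :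
    styleSpace r w (r + 1) k = resid r k := by
  have hrZ : (1 : ℤ) ≤ r := by exact_mod_cast hr
  refine le_antisymm (Submodule.span_le.2 ?_) (Submodule.span_le.2 ?_)
  · rintro _ ⟨t, ht, hg, rfl, hnot⟩
    rw [hw] at hnot
    change t.field ∉ leadImage r a k ⊔ laterSpan r k t at hnot
    have hfield := homogV_le_leadImage_sup ha hk (hg ▸ ht.field_mem_homogV r)
    cases t with
    | A l n => exact absurd (Submodule.mem_sup_left (vA_mem_leadImage ha hk ht hg)) hnot
    | B l n =>
      have hg' : l * r + 2 * n = k := hg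
      by_contra hres
      suffices resid r k ≤ laterSpan r k (.B l n) from
        hnot ((sup_le_sup le_rfl this : leadImage r a k ⊔ resid r k ≤ _) hfield)
      refine Submodule.span_le.2 ?_
      rintro _ ⟨m, hm, hm1, rfl⟩
      have hl := ht.1
      rcases hl.eq_or_lt with rfl | hl
      · obtain rfl : n = m := by omega
        exact (hres (Submodule.subset_span ⟨n, hm, hm1, rfl⟩)).elim
      · have hlr : 1 ≤ l * r := by nlinarith
        exact Submodule.subset_span ⟨.B 0 m, ⟨le_rfl, by omega, by omega⟩,
          by simpa [Term.grade] using hm, show n < m by omega, rfl⟩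
  · rintro _ ⟨n, hn, hn1, rfl⟩
    refine Submodule.subset_span ⟨.B 0 n, ⟨le_rfl, by omega, by omega⟩,
      by simpa [Term.grade] using hn, rfl, ?_⟩
    rw [hw]
    intro hmem
    have hker := cokerFun_leadImage (r := r) a hk (not_modEq_add hn1)
    have hlater : laterSpan r k (.B 0 n) ≤ leadImage r a k := by
      refine Submodule.span_le.2 ?_
      rintro _ ⟨u, hu, hg, hbefore, rfl⟩
      cases u with
      | A l m => exact vA_mem_leadImage ha hk hu hg
      | B l m =>
        have hg' : l * r + 2 * m = k := hg
        have hb' : n < m := hbefore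
        have := hu.1
        have hlr : 0 ≤ l * r := by positivity
        omega
    exact cokerFun_derivHam_vB_ne_zero r ha n (hker ((sup_le le_rfl hlater) hmem))

theorem coeff_field_eq_zero {t : Term} (ht : t.Admissible) (i : Fin 2) {p q : ℕ}
    (h : p + q ≠ t.deg + 1) : coeff (expo p q) (t.field i) = 0 := by
  cases t with
  | A l n =>
    obtain ⟨m, hm, rfl⟩ := ht.exists_A
    have h' : p + q ≠ n + 1 := h
    rw [Term.field, vA_eq hm, pderiv_zero_mono, pderiv_one_mono]
    fin_cases i
    · simp only [Fin.zero_eta, Matrix.cons_val_zero, MvPowerSeries.coeff_smul, coeff_mono]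
      by_cases hm2 : m = n + 2
      · simp [hm2]
      · rw [if_neg (by omega)]; simp
    · simp only [Fin.mk_one, Matrix.cons_val_one, Matrix.cons_val_zero, map_neg, MvPowerSeries.coeff_smul, coeff_mono]
      by_cases hm2 : m = 0
      · simp [hm2]
      · rw [if_neg (by omega)]; simp
  | B l n =>
    obtain ⟨m, hm, rfl⟩ := ht.exists_B
    have h' : p + q ≠ n + 1 := h
    rw [Term.field, vB_eq hm]
    fin_cases i
    · exact (coeff_mono _ _ _ _).trans (if_neg (by omega))
    · exact (coeff_mono _ _ _ _).trans (if_neg (by omega))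

/-- The divergence of a vector field. -/
def divergence : VField →ₗ[ℝ] Series :=
  ∑ i, (pderiv ℝ i).toLinearMap ∘ₗ LinearMap.proj i

theorem divergence_apply (v : VField) :
    divergence v = pderiv ℝ 0 (v 0) + pderiv ℝ 1 (v 1) := by
  simp [divergence]

theorem divergence_vA {n p : ℕ} (hp : p ≤ n + 2) : divergence (vA ((p : ℤ) - 1) n) = 0 := by
  rw [vA_eq hp, divergence_apply]
  simp only [Matrix.cons_val_zero, Matrix.cons_val_one, map_neg, Derivation.map_smul,
    pderiv_zero_mono, pderiv_one_mono]
  rw [smul_comm (p : ℝ), ← sub_eq_add_neg, sub_self]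

theorem divergence_vB {n l : ℕ} (hl : l ≤ n) :
    divergence (vB l n) = ((n : ℝ) + 2) • mono l (n - l) := by
  rw [vB_eq hl, divergence_apply]
  simp only [Matrix.cons_val_zero, Matrix.cons_val_one, pderiv_zero_mono, pderiv_one_mono,
    Nat.add_sub_cancel, ← add_smul]
  congr 1
  push_cast [hl]
  ring1

/-- Terms after an A-term have higher degree, so a coefficient of its own degree separates it. Terms
after a B-term may include A-terms of the same degree, but these are divergence-free and the B-term
is not. -/
theorem field_notMem_laterSpan (r : ℕ) (k : ℤ) {t : Term} (ht : t.Admissible) :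
    t.field ∉ laterSpan r k t := by
  cases t with
  | A l n =>
    have hlater : ∀ (i : Fin 2) (p q : ℕ), p + q = n + 1 → laterSpan r k (.A l n) ≤
        LinearMap.ker (coeff (expo p q) ∘ₗ LinearMap.proj i) := by
      intro i p q hpq
      refine Submodule.span_le.2 ?_
      rintro _ ⟨u, hu, -, hb, rfl⟩
      refine coeff_field_eq_zero hu i ?_
      have : n < u.deg := by cases u <;> exact hb
      omega
    obtain ⟨m, hm, rfl⟩ := ht.exists_A
    have hn2 : (n : ℝ) + 2 ≠ 0 := by positivity
    intro hmem
    by_cases hm2 : m = n + 2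
    · have h := hlater 1 (n + 1) 0 (by omega) hmem
      rw [LinearMap.mem_ker] at h
      change coeff (expo (n + 1) 0) (vA ((m : ℤ) - 1) n 1) = 0 at h
      rw [vA_eq hm, pderiv_zero_mono] at h
      subst hm2
      simp [coeff_mono, hn2] at h
    · have h := hlater 0 m (n + 1 - m) (by omega) hmem
      rw [LinearMap.mem_ker] at h
      change coeff (expo m (n + 1 - m)) (vA ((m : ℤ) - 1) n 0) = 0 at h
      rw [vA_eq hm, pderiv_one_mono] at h
      have hc : ((n + 2 - m : ℕ) : ℝ) ≠ 0 := by
        rw [Nat.cast_ne_zero]; omega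
      simp [coeff_mono, hn2, hc, show n + 2 - m - 1 = n + 1 - m by omega] at h
  | B l n =>
    obtain ⟨m, hm, rfl⟩ := ht.exists_B
    intro hmem
    have hlater : laterSpan r k (.B m n) ≤
        LinearMap.ker (coeff (expo m (n - m)) ∘ₗ divergence) := by
      refine Submodule.span_le.2 ?_
      rintro _ ⟨u, hu, -, hb, rfl⟩
      cases u with
      | A l' n' =>
        obtain ⟨p, hp, rfl⟩ := hu.exists_A
        change coeff _ (divergence (vA _ n')) = 0
        rw [divergence_vA hp, map_zero]
      | B l' n' =>
        obtain ⟨p, hp, rfl⟩ := hu.exists_B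
        have hb' : n < n' := hb
        change coeff _ (divergence (vB _ n')) = 0
        rw [divergence_vB hp, MvPowerSeries.coeff_smul, coeff_mono, if_neg (by omega), mul_zero]
    have h := hlater hmem
    rw [LinearMap.mem_ker] at h
    change coeff _ (divergence (vB _ n)) = 0 at h
    rw [divergence_vB hm, MvPowerSeries.coeff_smul, coeff_mono, if_pos ⟨rfl, rfl⟩, mul_one] at h
    have : (n : ℝ) + 2 ≠ 0 := by positivity
    exact this h

theorem styleSpace_eq_gradedL {r ρ : ℕ} {k : ℤ} {w : VField} (hw : dImage r w ρ k = ⊥) :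
    styleSpace r w ρ k = gradedL r k := by
  refine le_antisymm (Submodule.span_mono ?_) (Submodule.span_mono ?_)
  · rintro _ ⟨t, ht, hg, rfl, -⟩
    exact ⟨t, ht, hg, rfl⟩
  · rintro _ ⟨t, ht, hg, rfl⟩
    refine ⟨t, ht, hg, rfl, ?_⟩
    rw [hw, bot_sup_eq]
    exact field_notMem_laterSpan r k ht

/-- In grades up to r the image is zero, so the style space is the whole graded piece and imposes no
condition. Only the grades above r matter, where image and `resid` are complementary. -/
theorem inNormalForm_iff {r : ℕ} (hr : 1 ≤ r) {a : ℝ} (ha : a ≠ 0) {w : VField}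
    (hw : w - lead r a ∈ filtV r (r + 1)) :
    InNormalForm r (r + 1) w ↔ ∀ k : ℤ, (r : ℤ) + 1 ≤ k → component r k w ∈ resid r k := by
  have hlt : ∀ k : ℤ, k < r → component r k w = 0 := fun k hk => by
    rw [component_congr (by omega) hw, component_of_mem_homogV_ne hk.ne (lead_mem_homogV r a)]
  have hr0 : component r r w = lead r a := by
    rw [component_congr (by omega) hw, component_of_mem_homogV (lead_mem_homogV r a)]
  have hd : ∀ k, dImage r w (r + 1) k = leadImage r a k :=
    dImage_eq (fun i hi => hlt i (by omega)) hr0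
  constructor
  · intro h k hk
    rw [← styleSpace_eq_resid hr ha hk (hd k)]
    exact (h k).2.2
  · intro h k
    rcases le_or_gt ((r : ℤ) + 1) k with hk | hk
    · rw [styleSpace_eq_resid hr ha hk (hd k), hd]
      refine ⟨?_, disjoint_leadImage_resid ha hk, h k hk⟩
      rw [gradedL_eq_homogV r (by omega)]
      exact le_antisymm (sup_le (leadImage_le_homogV a hk) (resid_le_homogV r k))
        (homogV_le_leadImage_sup ha hk)
    · have hb : dImage r w (r + 1) k = ⊥ := by rw [hd, leadImage_eq_bot a (by omega)]
      rw [styleSpace_eq_gradedL hb, hb]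
      refine ⟨bot_sup_eq _, disjoint_bot_left, ?_⟩
      rcases (show k ≤ r by omega).lt_or_eq with hk' | rfl
      · rw [hlt k hk']; exact Submodule.zero_mem _
      · rw [hr0, gradedL_eq_homogV r (by omega)]
        exact lead_mem_homogV r a

/-! ### Existence of the normal form -/

/-- The only generator of positive grade that spoils tangency to the identity is x ∂y, in grade r.
Adding a multiple of L removes it without changing the bracket, because [L, L] = 0. -/
theorem exists_tangent {r : ℕ} (hr : 1 ≤ r) {a : ℝ} {j : ℤ} (hj : 1 ≤ j) {S : VField}
    (hS : S ∈ homogV r j) :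
    ∃ S' ∈ homogV r j, bracketRight (lead r a) S' = bracketRight (lead r a) S ∧
      ∀ i n, n.degree ≤ 1 → coeff n (S' i) = 0 := by
  refine ⟨S + coeff (expo 1 0) (S 1) • lead r a, Submodule.add_mem _ hS ?_, ?_, ?_⟩
  · by_cases h : j = r
    · subst h
      exact Submodule.smul_mem _ _ (lead_mem_homogV r a)
    · rw [hS 1 (expo 1 0), zero_smul]
      · exact Submodule.zero_mem _
      · rw [weight_expo, varWeight_one]
        push_cast
        omega
  · rw [map_add, map_smul, bracketRight_self, smul_zero, add_zero]
  · intro i n hn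
    have hdeg : n.degree = n 0 + n 1 := by
      rw [Finsupp.degree_eq_sum, Fin.sum_univ_two]
    rw [eq_expo n]
    generalize n 0 = p at *
    generalize n 1 = q at *
    have hpq : (p = 0 ∧ q = 0) ∨ (p = 1 ∧ q = 0) ∨ (p = 0 ∧ q = 1) := by omega
    fin_cases i
    · simp only [Fin.zero_eta, Pi.add_apply, Pi.smul_apply, lead, Matrix.cons_val_zero, map_add,
        MvPowerSeries.coeff_smul, coeff_mono]
      rw [if_neg (by omega), mul_zero, mul_zero, add_zero]
      refine hS 0 _ ?_
      rw [weight_expo, varWeight_zero]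
      rcases hpq with ⟨rfl, rfl⟩ | ⟨rfl, rfl⟩ | ⟨rfl, rfl⟩ <;> push_cast <;> omega
    · simp only [Fin.mk_one, Pi.add_apply, Pi.smul_apply, lead, Matrix.cons_val_one, map_add,
        MvPowerSeries.coeff_smul, coeff_mono, map_neg, Matrix.cons_val_zero]
      by_cases h : p = 1 ∧ q = 0
      · rw [h.1, h.2]; simp
      · rw [if_neg (by omega), neg_zero, mul_zero, add_zero]
        refine hS 1 _ ?_
        rw [weight_expo, varWeight_one]
        rcases hpq with ⟨rfl, rfl⟩ | ⟨rfl, rfl⟩ | ⟨rfl, rfl⟩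
        · push_cast; omega
        · exact absurd ⟨rfl, rfl⟩ h
        · push_cast; omega

/-- The error in the equation that says that `w` is `v` in the variables `φ`, after the time
rescaling by `T`. -/
def defect (v : VField) (φ : Fin 2 → Series) (T : Series) (w : VField) : VField := fun i =>
  ∑ j, w j * pderiv ℝ j (φ i) - (1 + T) * subst φ (v i)

/-- A change of state `φ`, a time rescaling `T` and a normal form `w`, correct up to terms of
grade `r + 1 + m`. -/
structure IsApprox (r : ℕ) (a : ℝ) (v : VField) (m : ℕ) (φ : Fin 2 → Series) (T : Series)
    (w : VField) : Prop where
  near : ∀ i, φ i - X i ∈ filt r (varWeight r i + 1)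
  tangent : ∀ i n, n.degree ≤ 1 → coeff n (φ i) = coeff n (X i : Series)
  time : T ∈ filt r 1
  leading : w - lead r a ∈ filtV r (r + 1)
  normal : ∀ k : ℤ, (r : ℤ) + 1 ≤ k → component r k w ∈ resid r k
  error : defect v φ T w ∈ filtV r (r + 1 + m)

theorem mem_filtV_of_sub_lead {r : ℕ} {a : ℝ} {v : VField}
    (hv : v - lead r a ∈ filtV r (r + 1)) : v ∈ filtV r r := by
  have := Submodule.add_mem _ (filtV_mono (k := r) (by omega) hv)
    (homogV_le_filtV _ _ (lead_mem_homogV r a))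
  rwa [sub_add_cancel] at this

theorem pderiv_X_apply (i j : Fin 2) :
    pderiv ℝ j (X i : Series) = if j = i then 1 else 0 := by
  split_ifs with h
  · rw [h, MvPowerSeries.pderiv_X_self]
  · exact MvPowerSeries.pderiv_X_of_ne (Ne.symm h)

theorem sum_mul_pderiv_eq (w : VField) (φ : Fin 2 → Series) (i : Fin 2) :
    ∑ j, w j * pderiv ℝ j (φ i) = w i + ∑ j, w j * pderiv ℝ j (φ i - X i) := by
  have h : ∑ j, w j * pderiv ℝ j (X i : Series) = w i := by
    simp only [pderiv_X_apply, mul_ite, mul_one, mul_zero, Finset.sum_ite_eq', Finset.mem_univ,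
      if_true]
  simp only [map_sub, mul_sub, Finset.sum_sub_distrib, h]
  ring1

theorem sum_mul_pderiv_mem {r : ℕ} {k M N : ℤ} {w : VField} (hw : w ∈ filtV r k) {f : Series}
    (hf : f ∈ filt r M) (h : N ≤ k + M) : ∑ j, w j * pderiv ℝ j f ∈ filt r N :=
  Submodule.sum_mem _ fun j _ => mul_mem_filt' (hw j) (pderiv_mem_filt hf j) (by omega)

theorem isApprox_lead {r : ℕ} {a : ℝ} {v : VField} (hv : v - lead r a ∈ filtV r (r + 1)) :
    IsApprox r a v 0 X 0 (lead r a) where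
  near i := by rw [sub_self]; exact Submodule.zero_mem _
  tangent _ _ _ := rfl
  time := Submodule.zero_mem _
  leading := by rw [sub_self]; exact Submodule.zero_mem _
  normal k hk := by
    rw [component_of_mem_homogV_ne (by omega) (lead_mem_homogV r a)]
    exact Submodule.zero_mem _
  error i := by
    rw [defect, sum_mul_pderiv_eq]
    simp only [sub_self, map_zero, mul_zero, Finset.sum_const_zero, add_zero, one_mul,
      MvPowerSeries.subst_self, id_eq]
    have := Submodule.neg_mem _ (hv i)
    rw [Pi.sub_apply, neg_sub] at this
    simpa using this

theorem IsApprox.step {r : ℕ} (hr : 1 ≤ r) {a : ℝ} (ha : a ≠ 0) {v : VField}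
    (hv : v - lead r a ∈ filtV r (r + 1)) {m : ℕ} {φ : Fin 2 → Series} {T : Series} {w : VField}
    (h : IsApprox r a v m φ T w) :
    ∃ φ' T' w', IsApprox r a v (m + 1) φ' T' w' ∧
      (∀ i, φ' i - φ i ∈ filt r (varWeight r i + 1 + m)) ∧ T' - T ∈ filt r (1 + m) ∧
      ∀ i, w' i - w i ∈ filt r (varWeight r i + (r + 1) + m) := by
  set k : ℤ := r + 1 + m with hk
  obtain ⟨τ, hτ, S₀, hS₀, c, hc, he⟩ := exists_homological_resid ha (by omega)
    (component_mem_homogV r k (defect v φ T w))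
  obtain ⟨S, hS, hb, htan⟩ := exists_tangent (a := a) hr (by omega) hS₀
  rw [← hb] at he
  have hτ' := homog_le_filt _ _ hτ
  have hS' := homogV_le_filtV _ _ hS
  have hcV := resid_le_homogV r k hc
  have hc' := homogV_le_filtV _ _ hcV
  have hvr := mem_filtV_of_sub_lead hv
  have hlead := homogV_le_filtV _ _ (lead_mem_homogV r a)
  have hwr := mem_filtV_of_sub_lead h.leading
  have near' : ∀ i, (φ + S) i - X i ∈ filt r (varWeight r i + 1) := fun i => by
    rw [Pi.add_apply, add_sub_right_comm]
    exact Submodule.add_mem _ (h.near i) (filt_mono (by omega) (hS' i))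
  have aφ := adm_of_sub_mem h.near
  have aφ' := adm_of_sub_mem near'
  -- To first order the new defect is the old one minus τ L + [S, L] + c, which is exactly its
  -- component of grade k.
  refine ⟨φ + S, T + τ, w - c, ⟨near', ?_, ?_, ?_, ?_, ?_⟩, ?_, ?_, ?_⟩
  · intro i n hn
    rw [Pi.add_apply, map_add, htan i n hn, add_zero, h.tangent i n hn]
  · exact Submodule.add_mem _ h.time (filt_mono (by omega) hτ')
  · rw [sub_right_comm]
    exact Submodule.sub_mem _ h.leading (filtV_mono (by omega) hc')
  · intro l hl
    rw [component_sub]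
    refine Submodule.sub_mem _ (h.normal l hl) ?_
    by_cases hlk : l = k
    · rw [hlk, component_of_mem_homogV hcV]; exact hc
    · rw [component_of_mem_homogV_ne hlk hcV]; exact Submodule.zero_mem _
  · intro i
    -- Apart from the first term, which has lost its grade k part, each summand pairs a correction
    -- with a deviation of positive grade, or is a Taylor remainder, so all lie beyond grade k.
    have key : defect v (φ + S) (T + τ) (w - c) i =
        (defect v φ T w - component r k (defect v φ T w)) i +
        ∑ j, (w - lead r a) j * pderiv ℝ j (S i) - ∑ j, c j * pderiv ℝ j (φ i - X i) -
        ∑ j, c j * pderiv ℝ j (S i) -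
        τ * ((subst (φ + S) (v i) - v i) + (v - lead r a) i) -
        T * (subst (φ + S) (v i) - subst φ (v i)) -
        (subst (φ + S) (v i) - subst φ (v i) - ∑ j, S j * pderiv ℝ j (v i)) -
        ∑ j, S j * pderiv ℝ j ((v - lead r a) i) := by
      have e1 := sum_mul_pderiv_eq c φ i
      have e2 := congrFun he i
      simp only [Pi.sub_apply, defect, e2, Pi.add_apply, Pi.smul_apply, smul_eq_mul,
        bracketRight_apply, Fin.sum_univ_two, map_add, map_sub] at e1 ⊢
      linear_combination (-1 : Series) * e1
    rw [key]
    have hk1 : varWeight r i + ((r : ℤ) + 1 + ((m + 1 : ℕ) : ℤ)) = varWeight r i + (k + 1) := by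
      push_cast; omega
    rw [hk1]
    refine Submodule.sub_mem _ (Submodule.sub_mem _ (Submodule.sub_mem _ (Submodule.sub_mem _
      (Submodule.sub_mem _ (Submodule.sub_mem _ (Submodule.add_mem _ ?_ ?_) ?_) ?_) ?_) ?_) ?_) ?_
    · exact sub_component_mem_filtV h.error i
    · exact sum_mul_pderiv_mem h.leading (hS' i) (by omega)
    · exact sum_mul_pderiv_mem hc' (h.near i) (by omega)
    · exact sum_mul_pderiv_mem hc' (hS' i) (by omega)
    · refine mul_mem_filt' (N := varWeight r i + (r + 1)) hτ' (Submodule.add_mem _ ?_ (hv i))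
        (by omega)
      exact filt_mono (by omega) (subst_sub_self_mem near' (hvr i))
    · refine mul_mem_filt' h.time (subst_sub_subst_mem aφ aφ' (d := k - r) (fun j => ?_) (hvr i))
        (by omega)
      rw [Pi.add_apply, add_sub_cancel_left]
      exact hS' j
    · exact filt_mono (by omega) (subst_add_sub_mem (by omega) h.near hS' (hvr i))
    · exact sum_mul_pderiv_mem hS' (hv i) (by omega)
  · intro i
    rw [Pi.add_apply, add_sub_cancel_left]
    exact filt_mono (by omega) (hS' i)
  · rw [add_sub_cancel_left]
    exact filt_mono (by omega) hτ'
  · intro i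
    rw [Pi.sub_apply, sub_sub_cancel_left]
    exact Submodule.neg_mem _ (filt_mono (by omega) (hc' i))

theorem exists_conjugation {r : ℕ} (hr : 1 ≤ r) {a : ℝ} (ha : a ≠ 0) {v : VField}
    (hv : v - lead r a ∈ filtV r (r + 1)) :
    ∃ φ T w, defect v φ T w = 0 ∧ IsApprox r a v 0 φ T w := by
  choose! nφ nT nw hstep using fun (m : ℕ) (φ : Fin 2 → Series) (T : Series) (w : VField)
    (h : IsApprox r a v m φ T w) => h.step hr ha hv
  let St := (Fin 2 → Series) × Series × VField
  let f : ℕ → St := fun m => Nat.rec (X, 0, lead r a)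
    (fun m x => (nφ m x.1 x.2.1 x.2.2, nT m x.1 x.2.1 x.2.2, nw m x.1 x.2.1 x.2.2)) m
  have hf : ∀ m, IsApprox r a v m (f m).1 (f m).2.1 (f m).2.2 := by
    intro m
    induction m with
    | zero => exact isApprox_lead hv
    | succ m ih => exact (hstep m _ _ _ ih).1
  choose φ hφ hφc using fun i => exists_filt_limit (fun m => (f m).1 i)
    fun m => (hstep m _ _ _ (hf m)).2.1 i
  -- The second conclusion of `exists_filt_limit` is kept for `φ`, since tangency in degree at most
  -- 1 is not implied by the filtration: x has positive relative weight in the y-component.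
  obtain ⟨T, hT, -⟩ := exists_filt_limit (fun m => (f m).2.1)
    fun m => (hstep m _ _ _ (hf m)).2.2.1
  choose w hw hwc using fun i => exists_filt_limit (fun m => (f m).2.2 i)
    fun m => (hstep m _ _ _ (hf m)).2.2.2 i
  have hwV : ∀ m : ℕ, w - (f m).2.2 ∈ filtV r (r + 1 + m) := fun m i =>
    filt_mono (by omega) (hw i m)
  have hnear : ∀ i, φ i - X i ∈ filt r (varWeight r i + 1) := fun i => by
    have := Submodule.add_mem _ (hφ i 0) (filt_mono (by simp) ((hf 0).near i))
    simpa using this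
  have hlead : w - lead r a ∈ filtV r (r + 1) := by
    have := Submodule.add_mem _ (hwV 0) (filtV_mono (by simp) (hf 0).leading)
    simpa using this
  have htime : T ∈ filt r 1 := by
    have := Submodule.add_mem _ (hT 0) (filt_mono (by simp) (hf 0).time)
    simpa using this
  have aφ := adm_of_sub_mem hnear
  have hvr := mem_filtV_of_sub_lead hv
  have hdef : ∀ m : ℕ, defect v φ T w ∈ filtV r (r + 1 + m) := by
    intro m i
    have aφm := adm_of_sub_mem (hf m).near
    have key : defect v φ T w i = defect v (f m).1 (f m).2.1 (f m).2.2 i +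
        ∑ j, (w - (f m).2.2) j * pderiv ℝ j (φ i) +
        ∑ j, (f m).2.2 j * pderiv ℝ j (φ i - (f m).1 i) -
        (T - (f m).2.1) * subst φ (v i) -
        (1 + (f m).2.1) * (subst φ (v i) - subst (f m).1 (v i)) := by
      simp only [defect, Fin.sum_univ_two, Pi.sub_apply, map_sub]
      ring1
    rw [key]
    refine Submodule.sub_mem _ (Submodule.sub_mem _ (Submodule.add_mem _ (Submodule.add_mem _
      ((hf m).error i) ?_) ?_) ?_) ?_
    · exact sum_mul_pderiv_mem (hwV m) (aφ i) (by omega)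
    · exact sum_mul_pderiv_mem (mem_filtV_of_sub_lead (hf m).leading) (hφ i m) (by omega)
    · exact mul_mem_filt' (hT m) (aφ.subst_mem (hvr i)) (by omega)
    · refine mul_mem_filt' (mem_filt_of_nonpos le_rfl _)
        (subst_sub_subst_mem aφm aφ (d := 1 + m) (fun j => ?_) (hvr i)) (by omega)
      exact filt_mono (by omega) (hφ j m)
  have hzero : defect v φ T w = 0 := by
    funext i
    exact eq_zero_of_forall_filt (r := r) fun m => filt_mono
      (by have := varWeight_pos r i; omega) (hdef m i)
  refine ⟨φ, T, w, hzero, hnear, fun i n hn => hφc i n _ fun m => (hf m).tangent i n hn, htime,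
    hlead, fun k hk => ?_, by rw [hzero]; exact Submodule.zero_mem _⟩
  obtain ⟨m, hm⟩ := Int.eq_ofNat_of_zero_le (show 0 ≤ k - r by omega)
  rw [component_congr (by omega) (hwV m)]
  exact (hf m).normal k hk

theorem exists_isOrbitalNormalForm {r : ℕ} (hr : 1 ≤ r) {a : ℝ} (ha : a ≠ 0) {v : VField}
    (hv : v - lead r a ∈ filtV r (r + 1)) : ∃ w, IsOrbitalNormalForm r (r + 1) v w := by
  obtain ⟨φ, T, w, h0, h⟩ := exists_conjugation hr ha hv
  have hT : MvPowerSeries.constantCoeff T = 0 := h.time 0 (by simp)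
  have hu : MvPowerSeries.constantCoeff (1 + T) ≠ 0 := by simp [hT]
  -- The pullback proper is w/(1+T), since the vanishing defect says Dφ · w = (1+T) v∘φ.
  refine ⟨w, ⟨φ, T, (1 + T)⁻¹ • w, ⟨h.tangent, fun i n hn => ?_⟩, hT, fun i => ?_, ?_⟩,
    (inNormalForm_iff hr ha h.leading).2 h.normal⟩
  · by_contra hlt
    exact hn (h.near i n (by omega))
  · have := congrFun h0 i
    rw [defect, Pi.zero_apply, sub_eq_zero] at this
    simp only [Pi.smul_apply, smul_eq_mul, mul_assoc]
    rw [← Finset.mul_sum, this, ← mul_assoc, MvPowerSeries.inv_mul_cancel _ hu, one_mul]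
  · rw [smul_smul, ← add_smul, ← one_add_mul, MvPowerSeries.mul_inv_cancel _ hu, one_smul]

/-! ### Series in `y` and the first level normal form -/

/-- The series `∑ k ≥ s, c k * y ^ k`. -/
def ySeries (s : ℕ) (c : ℕ → ℝ) : Series :=
  ofCoeff fun n => if n 0 = 0 ∧ s ≤ n 1 then c (n 1) else 0

theorem coeff_ySeries (s : ℕ) (c : ℕ → ℝ) (p q : ℕ) :
    coeff (expo p q) (ySeries s c) = if p = 0 ∧ s ≤ q then c q else 0 := by
  rw [ySeries, coeff_ofCoeff, expo_zero, expo_one]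

theorem ySeries_mem_filt (r s : ℕ) (c : ℕ → ℝ) : ySeries s c ∈ filt r (2 * s) := by
  intro n hn
  rw [eq_expo n, weight_expo] at hn
  rw [eq_expo n, coeff_ySeries, if_neg]
  rintro ⟨h0, h1⟩
  rw [h0] at hn
  push_cast at hn
  omega

theorem ySeries_sub_mem_filt (r s : ℕ) (c : ℕ → ℝ) :
    ySeries s c - c s • mono 0 s ∈ filt r (2 * (s + 1)) := by
  intro n hn
  rw [eq_expo n, weight_expo] at hn
  rw [eq_expo n, map_sub, MvPowerSeries.coeff_smul, coeff_ySeries, coeff_mono]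
  generalize n 0 = p at *
  generalize n 1 = q at *
  by_cases hp : p = 0
  · subst hp
    push_cast at hn
    by_cases hq : s = q
    · subst hq; simp
    · rw [if_neg (by omega), if_neg (by omega)]; simp
  · rw [if_neg (by omega), if_neg (by omega)]; simp

theorem finsum_shift (s e p q : ℕ) (i : ℕ) (c : ℕ → ℝ) :
    ∑ᶠ j, c (s + j) * (if i = p ∧ s + j + e = q then 1 else 0) =
      if i = p ∧ s + e ≤ q then c (q - e) else 0 := by
  split_ifs with h
  · rw [finsum_eq_single _ (q - e - s), if_pos ⟨h.1, by omega⟩, mul_one,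
      show s + (q - e - s) = q - e by omega]
    intro j hj
    rw [if_neg (by omega), mul_zero]
  · refine finsum_eq_zero_of_forall_eq_zero fun j => ?_
    rw [if_neg (by omega), mul_zero]

theorem coeff_formalSum (f : ℕ → VField) (i : Fin 2) (n : Fin 2 →₀ ℕ) :
    coeff n (formalSum f i) = ∑ᶠ j, coeff n (f j i) := rfl

theorem formalSum_vA (s : ℕ) (c : ℕ → ℝ) :
    formalSum (fun j => c (s + j) • vA (-1) (s + j)) = ![mono 0 1 * ySeries s c, 0] := by
  have hv : ∀ n, vA (-1) n = ![mono 0 (n + 1), 0] := by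
    intro n
    have h2 := vA_eq (n := n) (p := 0) (by omega)
    have h3 : (n : ℝ) + 2 ≠ 0 := by positivity
    norm_num at h2
    rw [h2, pderiv_zero_mono, pderiv_one_mono]
    funext i
    fin_cases i
    · simp [smul_smul, h3]
    · simp
  funext i
  refine series_ext fun p q => ?_
  rw [coeff_formalSum]
  simp only [Pi.smul_apply, hv, MvPowerSeries.coeff_smul]
  fin_cases i
  · simp only [Fin.zero_eta, Matrix.cons_val_zero, coeff_mono, coeff_mono_mul, coeff_ySeries]
    rw [finsum_shift]
    by_cases h : 0 = p ∧ s + 1 ≤ q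
    · rw [if_pos h, if_pos (by omega), if_pos (by omega)]
    · rw [if_neg h]
      split_ifs
      · omega
      · rfl
      · rfl
  · simp

theorem vB_zero_eq (n : ℕ) : vB 0 n = ![mono 1 n, mono 0 (n + 1)] := by
  have := vB_eq (n := n) (l := 0) (by omega)
  simpa using this

theorem formalSum_vB (s : ℕ) (c : ℕ → ℝ) :
    formalSum (fun j => c (s + j) • vB 0 (s + j)) =
      ![mono 1 0 * ySeries s c, mono 0 1 * ySeries s c] := by
  funext i
  refine series_ext fun p q => ?_
  rw [coeff_formalSum]
  simp only [Pi.smul_apply, vB_zero_eq, MvPowerSeries.coeff_smul]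
  fin_cases i
  · simp only [Fin.zero_eta, Matrix.cons_val_zero, coeff_mono, coeff_mono_mul, coeff_ySeries]
    rw [show (fun j => c (s + j) * if 1 = p ∧ s + j = q then (1 : ℝ) else 0) = fun j =>
      c (s + j) * if 1 = p ∧ s + j + 0 = q then 1 else 0 from rfl, finsum_shift]
    by_cases h : 1 = p ∧ s + 0 ≤ q
    · rw [if_pos h, if_pos (by omega), if_pos (by omega)]
    · rw [if_neg h]
      split_ifs
      · omega
      · rfl
      · rfl
  · simp only [Fin.mk_one, Matrix.cons_val_one, Matrix.cons_val_zero, coeff_mono, coeff_mono_mul,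
      coeff_ySeries]
    rw [finsum_shift]
    by_cases h : 0 = p ∧ s + 1 ≤ q
    · rw [if_pos h, if_pos (by omega), if_pos (by omega)]
    · rw [if_neg h]
      split_ifs
      · omega
      · rfl
      · rfl

theorem firstLevel_eq (r s : ℕ) (a b : ℕ → ℝ) :
    firstLevel r s a b = ![mono 0 1 * ySeries r a + mono 1 0 * ySeries s b,
      -mono 1 0 + mono 0 1 * ySeries s b] := by
  rw [firstLevel, formalSum_vA, formalSum_vB]
  have h := lead_eq 0 0
  rw [zero_smul, add_zero] at h
  rw [h]
  funext i
  fin_cases i <;> simp [lead]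

theorem mono_mem_filt {r i j : ℕ} {N : ℤ} (h : N ≤ ((r : ℤ) + 2) * i + 2 * j) :
    mono i j ∈ filt r N := filt_mono h (homog_le_filt _ _ (mono_mem_homog' r i j))

theorem firstLevel_sub_lead_mem {r s : ℕ} (a b : ℕ → ℝ) (hrs : r < 2 * s) :
    firstLevel r s a b - lead r (a r) ∈ filtV r (r + 1) := by
  have hb := ySeries_mem_filt r s b
  have h10 : mono 1 0 ∈ filt r (r + 2) := mono_mem_filt (by push_cast; omega)
  have h01 : mono 0 1 ∈ filt r 2 := mono_mem_filt (by push_cast; omega)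
  intro i
  rw [firstLevel_eq]
  fin_cases i
  · have e : mono 0 1 * ySeries r a + mono 1 0 * ySeries s b - a r • mono 0 (r + 1) =
        mono 0 1 * (ySeries r a - a r • mono 0 r) + mono 1 0 * ySeries s b := by
      rw [mul_sub, mul_smul_comm, mono_mul_mono, zero_add, add_comm 1 r]
      ring1
    change mono 0 1 * ySeries r a + mono 1 0 * ySeries s b - a r • mono 0 (r + 1) ∈
      filt r (varWeight r 0 + (r + 1))
    rw [e, varWeight_zero]
    exact Submodule.add_mem _ (mul_mem_filt' h01 (ySeries_sub_mem_filt r r a) (by omega))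
      (mul_mem_filt' h10 hb (by omega))
  · change -mono 1 0 + mono 0 1 * ySeries s b - -mono 1 0 ∈ filt r (varWeight r 1 + (r + 1))
    rw [add_sub_cancel_left, varWeight_one]
    exact mul_mem_filt' h01 hb (by omega)

/-! ### Transformations and the leading part -/

theorem leading_of_conjugate {r : ℕ} {a : ℝ} {v w : VField} {φ : Fin 2 → Series} {T : Series}
    (hv : v - lead r a ∈ filtV r (r + 1)) (hφ : ∀ i, φ i - X i ∈ filt r (varWeight r i + 1))
    (hT : T ∈ filt r 1)
    (h : ∀ i, ∑ j, w j * pderiv ℝ j (φ i) = (1 + T) * subst φ (v i)) :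
    w - lead r a ∈ filtV r (r + 1) := by
  have hvr := mem_filtV_of_sub_lead hv
  have aφ := adm_of_sub_mem hφ
  have hw : ∀ i, w i = (1 + T) * subst φ (v i) - ∑ j, w j * pderiv ℝ j (φ i - X i) := fun i => by
    rw [← h, sum_mul_pderiv_eq, add_sub_cancel_right]
  have hrhs : ∀ i, (1 + T) * subst φ (v i) ∈ filt r (varWeight r i + r) := fun i =>
    mul_mem_filt' (mem_filt_of_nonpos le_rfl _) (aφ.subst_mem (hvr i)) (by omega)
  -- Bootstrap: grade at least -(r+2) is no condition on `w`, and each use of w = (1+T) v∘φ - w(φ -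
  -- id) gains one grade until r is reached.
  have hstep : ∀ t : ℕ, -((r : ℤ) + 2) + t ≤ r → w ∈ filtV r (-((r : ℤ) + 2) + t) := by
    intro t
    induction t with
    | zero =>
      intro _ i
      refine mem_filt_of_nonpos ?_ _
      fin_cases i
      · simp [varWeight_zero]
      · simp [varWeight_one]
    | succ t ih =>
      intro ht i
      push_cast at ht ⊢
      rw [hw i]
      exact Submodule.sub_mem _ (filt_mono (by omega) (hrhs i))
        (sum_mul_pderiv_mem (ih (by omega)) (hφ i) (by omega))
  have hwr : w ∈ filtV r r := by
    have := hstep (2 * r + 2) (by push_cast; omega)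
    exact filtV_mono (by push_cast; omega) this
  intro i
  have key : (w - lead r a) i = (subst φ (v i) - v i) + (v - lead r a) i + T * subst φ (v i) -
      ∑ j, w j * pderiv ℝ j (φ i - X i) := by
    rw [Pi.sub_apply, hw i, Pi.sub_apply]
    ring1
  rw [key]
  refine Submodule.sub_mem _ (Submodule.add_mem _ (Submodule.add_mem _ ?_ (hv i)) ?_) ?_
  · exact filt_mono (by omega) (subst_sub_self_mem hφ (hvr i))
  · exact mul_mem_filt' hT (aφ.subst_mem (hvr i)) (by omega)
  · exact sum_mul_pderiv_mem hwr (hφ i) (by omega)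

/-! ### Transport of approximate first integrals. -/

/-- A first integral of `v` up to terms of weight `N` is transported by a change of variables. -/
theorem deriv_subst_mem {r : ℕ} {v w : VField} {φ : Fin 2 → Series} {T : Series} (hφ : Adm r φ)
    (h : ∀ i, ∑ j, w j * pderiv ℝ j (φ i) = (1 + T) * subst φ (v i)) {K : Series} {N : ℤ}
    (hK : ∑ i, v i * pderiv ℝ i K ∈ filt r N) :
    ∑ j, w j * pderiv ℝ j (subst φ K) ∈ filt r N := by
  -- By the chain rule w(K∘φ) = (1+T) (v(K))∘φ, and neither substitution nor the unit factor lowers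
  -- weights.
  have e : ∑ j, w j * pderiv ℝ j (subst φ K) =
      (1 + T) * subst φ (∑ i, v i * pderiv ℝ i K) := by
    have hs := hφ.hasSubst
    simp only [pderiv_subst hφ, Fin.sum_univ_two, MvPowerSeries.subst_add hs,
      MvPowerSeries.subst_mul hs] at h ⊢
    linear_combination (subst φ (pderiv ℝ 0 K)) * h 0 + (subst φ (pderiv ℝ 1 K)) * h 1
  rw [e]
  exact mul_mem_filt' (mem_filt_of_nonpos le_rfl _) (hφ.subst_mem hK) (by omega)

/-- The Hamiltonian of the part of `firstLevel` that consists of the `A`-terms. -/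
def firstHam (r : ℕ) (a : ℕ → ℝ) : Series :=
  (1 / 2 : ℝ) • mono 2 0 + ySeries (r + 2) fun k => a (k - 2) / k

theorem pderiv_zero_firstHam (r : ℕ) (a : ℕ → ℝ) : pderiv ℝ 0 (firstHam r a) = mono 1 0 := by
  have h : pderiv ℝ 0 (ySeries (r + 2) fun k => a (k - 2) / k) = 0 := by
    refine series_ext fun p q => ?_
    rw [MvPowerSeries.coeff_pderiv, show expo p q + single 0 1 = expo (p + 1) q by
      ext k; fin_cases k <;> simp, coeff_ySeries, if_neg (by omega), zero_mul, map_zero]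
  rw [firstHam, map_add, Derivation.map_smul, pderiv_zero_mono, h, smul_smul]
  norm_num

theorem pderiv_one_firstHam (r : ℕ) (a : ℕ → ℝ) :
    pderiv ℝ 1 (firstHam r a) = mono 0 1 * ySeries r a := by
  have h : pderiv ℝ 1 (ySeries (r + 2) fun k => a (k - 2) / k) = mono 0 1 * ySeries r a := by
    refine series_ext fun p q => ?_
    rw [MvPowerSeries.coeff_pderiv, show expo p q + single 1 1 = expo p (q + 1) by
      ext k; fin_cases k <;> simp, coeff_ySeries, coeff_mono_mul, coeff_ySeries, expo_one]
    by_cases hc : p = 0 ∧ r + 1 ≤ q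
    · have hq : (q : ℝ) + 1 ≠ 0 := by positivity
      rw [if_pos (by omega), if_pos (by omega), if_pos (by omega),
        show q + 1 - 2 = q - 1 by omega]
      push_cast
      field_simp
    · rw [if_neg (by omega), zero_mul]
      split_ifs
      · omega
      · rfl
      · rfl
  rw [firstHam, map_add, Derivation.map_smul, pderiv_one_mono, h]
  simp

/-- The A-terms preserve their Hamiltonian, so only the B-terms contribute: they multiply x^2 + y ∑
a_k y^(k+1), of weight at least 2r+4, by ∑ b_k y^k, of weight at least 2s. -/
theorem firstLevel_firstHam_mem (r s : ℕ) (a b : ℕ → ℝ) :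
    ∑ i, firstLevel r s a b i * pderiv ℝ i (firstHam r a) ∈ filt r (2 * r + 4 + 2 * s) := by
  have ha := ySeries_mem_filt r r a
  have hb := ySeries_mem_filt r s b
  have h10 : mono 1 0 ∈ filt r (r + 2) := mono_mem_filt (by push_cast; omega)
  have h01 : mono 0 1 ∈ filt r 2 := mono_mem_filt (by push_cast; omega)
  have e : ∑ i, firstLevel r s a b i * pderiv ℝ i (firstHam r a) =
      mono 1 0 * (mono 1 0 * ySeries s b) +
        mono 0 1 * (mono 0 1 * (ySeries r a * ySeries s b)) := by
    rw [Fin.sum_univ_two, pderiv_zero_firstHam, pderiv_one_firstHam, firstLevel_eq]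
    simp only [Matrix.cons_val_zero, Matrix.cons_val_one]
    ring1
  rw [e]
  exact Submodule.add_mem _
    (mul_mem_filt' h10 (mul_mem_filt h10 hb) (by omega))
    (mul_mem_filt' h01 (mul_mem_filt h01 (mul_mem_filt ha hb)) (by omega))

theorem firstHam_sub_ham_mem (r : ℕ) (a : ℕ → ℝ) :
    firstHam r a - ham r (a r) ∈ filt r (2 * r + 5) := by
  have h := ySeries_sub_mem_filt r (r + 2) fun k => a (k - 2) / k
  have e : firstHam r a - ham r (a r) = ySeries (r + 2) (fun k => a (k - 2) / k) -
      (a (r + 2 - 2) / ((r + 2 : ℕ) : ℝ)) • mono 0 (r + 2) := by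
    rw [firstHam, ham, Nat.add_sub_cancel, add_sub_add_left_eq_sub]
    push_cast
    rfl
  rw [e]
  exact filt_mono (by push_cast; omega) h

/-! ### The form of the normal form -/

theorem exists_coeff_of_resid {r : ℕ} {w : VField}
    (h : ∀ k : ℤ, (r : ℤ) + 1 ≤ k → component r k w ∈ resid r k) :
    ∃ c : ℕ → ℝ, (∀ n : ℕ, (n : ℤ) ≡ -1 [ZMOD ((r : ℤ) + 2)] → c n = 0) ∧
      (∀ n : ℕ, 2 * n ≤ r → c n = 0) ∧
      (∀ n : ℕ, r < 2 * n → component r (2 * n) w = c n • vB 0 n) ∧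
      ∀ k : ℤ, (r : ℤ) + 1 ≤ k → (∀ n : ℕ, 2 * (n : ℤ) ≠ k) → component r k w = 0 := by
  have key : ∀ n : ℕ, ∃ c : ℝ, ((n : ℤ) ≡ -1 [ZMOD ((r : ℤ) + 2)] → c = 0) ∧
      (2 * n ≤ r → c = 0) ∧ (r < 2 * n → component r (2 * n) w = c • vB 0 n) := by
    intro n
    by_cases hn : r < 2 * n
    · have hmem := h (2 * n) (by omega)
      by_cases hn1 : (n : ℤ) ≡ -1 [ZMOD ((r : ℤ) + 2)]
      · refine ⟨0, fun _ => rfl, fun _ => rfl, fun _ => ?_⟩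
        have hb : resid r (2 * n) ≤ ⊥ := by
          refine Submodule.span_le.2 ?_
          rintro _ ⟨m, h1, h2, -⟩
          rw [show m = n by omega] at h2
          exact absurd hn1 h2
        rw [zero_smul]
        exact (Submodule.mem_bot ℝ).1 (hb hmem)
      · obtain ⟨c, hc⟩ : ∃ c : ℝ, c • vB 0 n = component r (2 * n) w := by
          refine Submodule.mem_span_singleton.1 (Submodule.span_mono ?_ hmem)
          rintro _ ⟨m, h1, -, rfl⟩
          rw [show m = n by omega]
          rfl
        exact ⟨c, fun h' => absurd h' hn1, fun h' => absurd hn (by omega), fun _ => hc.symm⟩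
    · exact ⟨0, fun _ => rfl, fun _ => rfl, fun h' => absurd h' hn⟩
  choose c hc using key
  refine ⟨c, fun n => (hc n).1, fun n => (hc n).2.1, fun n => (hc n).2.2, fun k hk hne => ?_⟩
  have hb : resid r k ≤ ⊥ := by
    refine Submodule.span_le.2 ?_
    rintro _ ⟨m, h1, -, -⟩
    exact absurd h1 (hne m)
  exact (Submodule.mem_bot ℝ).1 (hb (h k hk))

theorem mem_filtV_of_component {r : ℕ} {k l : ℤ} {v : VField} (hv : v ∈ filtV r k)
    (h : ∀ m, k ≤ m → m < l → component r m v = 0) : v ∈ filtV r l := by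
  intro i n hn
  by_cases hlt : weight r n < varWeight r i + k
  · exact hv i n hlt
  · have := congrArg (coeff n) (congrFun (h (weight r n - varWeight r i) (by omega) (by omega)) i)
    rw [coeff_component, if_pos rfl] at this
    simpa using this

theorem sum_mul_pderiv_lead (r : ℕ) (a : ℝ) (f : Series) :
    ∑ j, lead r a j * pderiv ℝ j f = lieLead r a f := by
  simp [Fin.sum_univ_two, lead, lieLead_apply]
  ring1

theorem sum_mul_pderiv_ham (r : ℕ) (a : ℝ) (U : VField) :
    ∑ j, U j * pderiv ℝ j (ham r a) = derivHam r a U := by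
  have hr : (r : ℝ) + 2 ≠ 0 := by positivity
  have h0 : pderiv ℝ 0 (ham r a) = mono 1 0 := by
    rw [ham, map_add, Derivation.map_smul, Derivation.map_smul, pderiv_zero_mono,
      pderiv_zero_mono, smul_smul]
    norm_num
  have h1 : pderiv ℝ 1 (ham r a) = a • mono 0 (r + 1) := by
    rw [ham, map_add, Derivation.map_smul, Derivation.map_smul, pderiv_one_mono,
      pderiv_one_mono, smul_smul, smul_smul]
    push_cast
    rw [div_mul_cancel₀ _ hr]
    simp
  rw [Fin.sum_univ_two, h0, h1, derivHam_apply]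
  ring1

/-- If the first integral `ham r a` of the leading part extends to one of `w` up to terms of
weight `2 r + 2 n + 5`, then the leading perturbation `c • B^0_n` of `w` vanishes. -/
theorem coeff_eq_zero_of_integral {r : ℕ} {a : ℝ} (ha : a ≠ 0) {n : ℕ}
    (hn1 : ¬ (n : ℤ) ≡ -1 [ZMOD ((r : ℤ) + 2)]) {w : VField} {c : ℝ} {K : Series}
    (hw : w - lead r a ∈ filtV r (2 * n)) (hc : w - lead r a - c • vB 0 n ∈ filtV r (2 * n + 1))
    (hK : K - ham r a ∈ filt r (2 * r + 5))
    (hwK : ∑ j, w j * pderiv ℝ j K ∈ filt r (2 * n + 2 * r + 5)) : c = 0 := by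
  have hham := homog_le_filt _ _ (ham_mem_homog r a)
  -- Split K as h + (K - h) and w as L + c B^0_n + rest, and use L(h) = 0. `cokerFun` kills the
  -- first summand as an image of L and the next two by weight, leaving only c B^0_n(h).
  have e : ∑ j, w j * pderiv ℝ j K =
      lieLead r a (K - ham r a) + ∑ j, (w - lead r a) j * pderiv ℝ j (K - ham r a) +
      ∑ j, (w - lead r a - c • vB 0 n) j * pderiv ℝ j (ham r a) +
      c • derivHam r a (vB 0 n) := by
    rw [← sum_mul_pderiv_ham, map_sub (lieLead r a), lieLead_ham, sub_zero,
      ← sum_mul_pderiv_lead r a K]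
    simp only [Fin.sum_univ_two, Pi.sub_apply, Pi.smul_apply, map_sub,
      MvPowerSeries.smul_eq_C_mul]
    ring1
  have hm : ((2 : ℤ) * (n + r + 2 : ℕ) + 1) = 2 * n + 2 * r + 5 := by push_cast; ring1
  have hz : ∀ f, f ∈ filt r (2 * n + 2 * r + 5) → cokerFun r a (n + r + 2) f = 0 := fun f hf =>
    cokerFun_eq_zero_of_mem_filt a (by rwa [hm])
  have h := hz _ hwK
  rw [e, map_add, map_add, map_add, cokerFun_lieLead r a (not_modEq_add hn1),
    hz _ (sum_mul_pderiv_mem hw hK (by omega)), hz _ (sum_mul_pderiv_mem hc hham (by omega)),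
    map_smul, smul_eq_mul, zero_add, zero_add, zero_add] at h
  exact (mul_eq_zero.1 h).resolve_right (cokerFun_derivHam_vB_ne_zero r ha n)

theorem eq_of_coeff {r s : ℕ} {a : ℝ} (hrs : r < 2 * s) {w : VField} {c : ℕ → ℝ}
    (hw : w - lead r a ∈ filtV r (r + 1))
    (hc : ∀ n : ℕ, r < 2 * n → component r (2 * n) w = c n • vB 0 n)
    (hodd : ∀ k : ℤ, (r : ℤ) + 1 ≤ k → (∀ n : ℕ, 2 * (n : ℤ) ≠ k) → component r k w = 0)
    (hs : ∀ n < s, c n = 0) :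
    w = lead r a + formalSum fun j => c (s + j) • vB 0 (s + j) := by
  have hcoeff : ∀ (i : Fin 2) (p q : ℕ) (k : ℤ), weight r (expo p q) - varWeight r i = k →
      coeff (expo p q) ((w - lead r a) i) =
        if r < k then coeff (expo p q) (component r k w i) else 0 := by
    intro i p q k hk
    split_ifs with h
    · rw [coeff_component, if_pos hk, Pi.sub_apply, map_sub,
        lead_mem_homogV r a i _ (by omega), sub_zero]
    · exact hw i _ (by omega)
  have hvanish : ∀ (i : Fin 2) (p q : ℕ) (k : ℤ), (r : ℤ) < k →
      (∀ n : ℕ, coeff (expo p q) (vB 0 n i) = 0) → coeff (expo p q) (component r k w i) = 0 := by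
    intro i p q k hk h
    by_cases hn : ∃ n : ℕ, 2 * (n : ℤ) = k
    · obtain ⟨n, rfl⟩ := hn
      rw [hc n (by omega), Pi.smul_apply, MvPowerSeries.coeff_smul, h, mul_zero]
    · rw [hodd k (by omega) (not_exists.1 hn)]
      simp
  rw [← sub_eq_iff_eq_add', formalSum_vB]
  funext i
  refine series_ext fun p q => ?_
  rw [hcoeff i p q _ rfl, weight_expo]
  fin_cases i
  · simp only [Fin.zero_eta, Matrix.cons_val_zero, coeff_mono_mul, coeff_ySeries, varWeight_zero,
      Nat.sub_zero, zero_le, and_true]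
    by_cases hp : p = 1
    · subst hp
      rw [if_pos le_rfl, show ((r : ℤ) + 2) * (1 : ℕ) + 2 * q - (r + 2) = 2 * q by push_cast; ring1]
      by_cases hq : r < 2 * q
      · rw [if_pos (by omega), hc q hq, Pi.smul_apply, MvPowerSeries.coeff_smul, vB_zero_eq,
          Matrix.cons_val_zero, coeff_mono, if_pos ⟨rfl, rfl⟩, mul_one]
        split_ifs with h
        · rfl
        · exact hs q (by omega)
      · rw [if_neg (by omega), if_neg (by omega)]
    · have h0 : (if 1 ≤ p then if p - 1 = 0 ∧ s ≤ q then c q else 0 else 0) = 0 := by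
        split_ifs
        · omega
        · rfl
        · rfl
      rw [h0]
      split_ifs with h
      · refine hvanish 0 p q _ h fun n => ?_
        rw [vB_zero_eq, Matrix.cons_val_zero, coeff_mono, if_neg (by omega)]
      · rfl
  · simp only [Fin.mk_one, Matrix.cons_val_one, Matrix.cons_val_zero, coeff_mono_mul,
      coeff_ySeries, varWeight_one, Nat.sub_zero, zero_le, true_and]
    by_cases hp : p = 0 ∧ 1 ≤ q
    · obtain ⟨rfl, hq1⟩ := hp
      obtain ⟨n, rfl⟩ : ∃ n, q = n + 1 := ⟨q - 1, by omega⟩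
      rw [if_pos hq1, Nat.add_sub_cancel,
        show ((r : ℤ) + 2) * (0 : ℕ) + 2 * (n + 1 : ℕ) - 2 = 2 * n by push_cast; ring1]
      by_cases hn : r < 2 * n
      · rw [if_pos (by omega), hc n hn, Pi.smul_apply, MvPowerSeries.coeff_smul, vB_zero_eq,
          Matrix.cons_val_one, Matrix.cons_val_zero, coeff_mono, if_pos ⟨rfl, rfl⟩, mul_one]
        split_ifs with h
        · rfl
        · exact hs n (by omega)
      · rw [if_neg (by omega), if_neg (by omega)]
    · have h0 : (if 1 ≤ q then if p = 0 ∧ s ≤ q - 1 then c (q - 1) else 0 else 0) = 0 := by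
        split_ifs
        · omega
        · rfl
        · rfl
      rw [h0]
      split_ifs with h
      · refine hvanish 1 p q _ h fun n => ?_
        rw [vB_zero_eq, Matrix.cons_val_one, Matrix.cons_val_zero, coeff_mono, if_neg (by omega)]
      · rfl

theorem form_of_isOrbitalNormalForm {r s : ℕ} (hr : 1 ≤ r) {a b : ℕ → ℝ} (ha : a r ≠ 0)
    (hrs : r < 2 * s) {w : VField}
    (h : IsOrbitalNormalForm r (r + 1) (firstLevel r s a b) w) :
    ∃ c : ℕ → ℝ, (∀ k : ℕ, (k : ℤ) ≡ -1 [ZMOD ((r : ℤ) + 2)] → c k = 0) ∧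
      w = vA 1 0 + a r • vA (-1) r + formalSum fun j => c (s + j) • vB 0 (s + j) := by
  obtain ⟨⟨φ, T, u, hφ, hT, hu, hwu⟩, hnf⟩ := h
  have near : ∀ i, φ i - X i ∈ filt r (varWeight r i + 1) := fun i n hn => by
    by_contra hne
    have := hφ.graded i n hne
    omega
  have hT1 : T ∈ filt r 1 := by
    intro n hn
    have h0 := weight_nonneg r n
    have : n = 0 := by
      have h1 : 0 ≤ (r : ℤ) * n 0 := by positivity
      simp only [weight, add_mul] at hn h0
      ext i
      fin_cases i
      · change n 0 = 0
        omega
      · change n 1 = 0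
        omega
    rw [this]
    exact hT
  have heq : ∀ i, ∑ j, w j * pderiv ℝ j (φ i) = (1 + T) * subst φ (firstLevel r s a b i) := by
    intro i
    rw [← hu i, hwu, Finset.mul_sum]
    refine Finset.sum_congr rfl fun j _ => ?_
    simp only [Pi.add_apply, Pi.smul_apply, smul_eq_mul]
    ring1
  have hlead := leading_of_conjugate (firstLevel_sub_lead_mem a b hrs) near hT1 heq
  obtain ⟨c, hc1, hc2, hc3, hc4⟩ :=
    exists_coeff_of_resid ((inNormalForm_iff hr ha hlead).1 hnf)
  have aφ := adm_of_sub_mem near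
  have hham := firstHam_sub_ham_mem r a
  have hK : subst φ (firstHam r a) - ham r (a r) ∈ filt r (2 * r + 5) := by
    have hF : firstHam r a ∈ filt r (2 * r + 4) := by
      have := Submodule.add_mem _ (filt_mono (M := 2 * r + 4) (by omega) hham)
        (homog_le_filt _ _ (ham_mem_homog r (a r)))
      rwa [sub_add_cancel] at this
    have := Submodule.add_mem _ (filt_mono (M := 2 * r + 5) (by omega)
      (subst_sub_self_mem near hF)) hham
    rwa [sub_add_sub_cancel] at this
  have hwK := deriv_subst_mem aφ heq (firstLevel_firstHam_mem r s a b)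
  -- Strong induction: once all earlier coefficients vanish, c_n B^0_n is the leading perturbation
  -- of L in `w`, and n < s makes the transported first integral accurate enough to detect it.
  have hs : ∀ n < s, c n = 0 := by
    intro n
    induction n using Nat.strong_induction_on with
    | _ n ih =>
      intro hns
      by_cases hn : 2 * n ≤ r
      · exact hc2 n hn
      by_cases hn1 : (n : ℤ) ≡ -1 [ZMOD ((r : ℤ) + 2)]
      · exact hc1 n hn1
      have hcomp : ∀ k : ℤ, (r : ℤ) + 1 ≤ k → component r k (w - lead r (a r)) =
          component r k w := fun k hk => by
        rw [component_sub, component_of_mem_homogV_ne (by omega) (lead_mem_homogV r (a r)),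
          sub_zero]
      have hw : w - lead r (a r) ∈ filtV r (2 * n) := by
        refine mem_filtV_of_component hlead fun m hm hmn => ?_
        rw [hcomp m hm]
        by_cases hex : ∃ n' : ℕ, 2 * (n' : ℤ) = m
        · obtain ⟨n', rfl⟩ := hex
          rw [hc3 n' (by omega), ih n' (by omega) (by omega), zero_smul]
        · exact hc4 m hm (not_exists.1 hex)
      refine coeff_eq_zero_of_integral ha hn1 hw ?_ hK (filt_mono (by omega) hwK)
      rw [← hc3 n (by omega), ← hcomp _ (by omega)]
      exact sub_component_mem_filtV hw
  refine ⟨c, hc1, ?_⟩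
  rw [lead_eq]
  exact eq_of_coeff hrs hlead hc3 hc4 hs

end CuspNF

end

theorem mainTheorem1 (r s : ℕ) (a b : ℕ → ℝ) (hr : 1 ≤ r) (hs : 1 ≤ s)
    (ha : a r ≠ 0) (hb : b s ≠ 0) (hrs : r < 2 * s) :
    (∃ w : CuspNF.VField,
      CuspNF.IsOrbitalNormalForm r (r + 1) (CuspNF.firstLevel r s a b) w) ∧
    ∀ w : CuspNF.VField,
      CuspNF.IsOrbitalNormalForm r (r + 1) (CuspNF.firstLevel r s a b) w →
      ∃ c : ℕ → ℝ, (∀ k : ℕ, (k : ℤ) ≡ -1 [ZMOD ((r : ℤ) + 2)] → c k = 0) ∧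
        w = CuspNF.vA 1 0 + a r • CuspNF.vA (-1) r +
          CuspNF.formalSum (fun j => c (s + j) • CuspNF.vB 0 (s + j)) := by
  exact ⟨CuspNF.exists_isOrbitalNormalForm hr ha (CuspNF.firstLevel_sub_lead_mem a b hrs),
    fun _ hw => CuspNF.form_of_isOrbitalNormalForm hr ha hrs hw⟩
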